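/- Fix a subfield $K\subseteq\mathbb R$ with effective arithmetic: its elements are coded by natural numbers in such a way that equality is decidable and addition, multiplication and division are computable (for example $K=\mathbb Q$). All matrices and vectors given as inputs have entries in $K$. Let $\Sigma$ be a nonempty finite alphabet. For a family $\{A_a\mid a\in\Sigma\}$ of $n\times n$ matrices put $A_v=A_{v_1}\cdots A_{v_k}$ for a word $v=v_1\cdots v_k$ and, for an infinite word $w\in\Sigma^\omega$, $A_w=\lim_{k\to\infty}A_{\mathrm{pref}_k(w)}$ if this limit exists. The family is *stable* if $A_w=0$ for all $w\in\Sigma^\omega$; it is a *continuous RCP set* if $A_w$ exists for all $w\in\Sigma^\omega$ and $w\mapsto A_w$ is continuous (with the prefix metric on $\Sigma^\omega$). A weighted finite automaton (WFA) $\mathcal A$ with $n\ge 0$ states over $\Sigma$ consists of an initial row vector $I$, a final column vector $F$ (both of length $n$) and $n\times n$ weight matrices $A_a$, $a\in\Sigma$. Its word function is $F_{\mathcal A}(v)=IA_vF$, and its $\omega$-function is $f_{\mathcal A}(w)=\lim_{k\to\infty}F_{\mathcal A}(\mathrm{pref}_k(w))$, defined where the limit exists; $f_{\mathcal A}$ is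 called continuous if it is defined and continuous on all of $\Sigma^\omega$. The WFA is *average preserving* (ap) if $\sum_{a\in\Sigma}A_aF=|\Sigma|F$, and *minimal* if $\dim\langle IA_u\mid u\in\Sigma^*\rangle=\dim\langle A_uF\mid u\in\Sigma^*\rangle=n$. Consider the following decision problems; the alphabet and the dimension are part of the input. - Matrix Product Stability: given a nonempty finite family of square matrices of equal size, is it stable? - Matrix Product Continuity: given such a family, is it a continuous RCP set? - Ap-WFA continuity: given an ap WFA $\mathcal A$, is $f_{\mathcal A}$ continuous? **Theorem.** Ap-WFA continuity and Matrix Product Continuity are both algorithmically reducible to Matrix Product Stability: in each case there is a computable map that takes every input of the first problem to an input of Matrix Product Stability with the same answer. Moreover, for ap WFA the following procedure works. There are a computable map $\mathcal A\mapsto\mathcal A'$ (minimization), a computable test (for zero), and a computable partial construction with decidable success (canonical form) such that, for every ap WFA $\mathcal A$: 1. $\mathcal A'$ is minimal and ap, has the same alphabet as $\mathcal A$, and $F_{\mathcal A'}=F_{\mathcal A}$; 2. the test answers "yes" on $\mathcal A'$ if and only if $f_{\mathcal A'}$ is everywhere defined and equal to $0$; 3. the canonical form construction fails on $\mathcal A'$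 if and only if there is no row vector $I_c\ne 0$ with $I_cA'_a=I_c$ for all $a\in\Sigma$; if it succeeds, it returns a WFA obtained from $\mathcal A'$ by a change of basis (that is, with distributions $IM$, $M^{-1}F$ and matrices $M^{-1}A'_aM$ for an invertible $M$) whose weight matrices have the form $$\begin{pmatrix}B_a&\mathbf b_a\\ \mathbf 0&1\end{pmatrix},$$ together with the matrices $B_a$, $a\in\Sigma$; 4. $f_{\mathcal A}$ is continuous if and only if the test answers "yes" on $\mathcal A'$, or the canonical form construction succeeds on $\mathcal A'$ and $\{B_a\mid a\in\Sigma\}$ is stable. -/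

import Mathlib

open Filter Topology

/-- An indexed finite family `{A_a | a ∈ Σ}` of square matrices of a common size over `R`,
with `Σ = Fin letters` and size `dim × dim`. -/
structure MatrixFamily (R : Type*) where
  letters : ℕ
  dim : ℕ
  mat : Fin letters → Matrix (Fin dim) (Fin dim) R

/-- A weighted finite automaton over `R`: a family of weight matrices (one for each letter),
whose dimension is the number of states, with an initial (row) and a final (column) vector.
The state set may be empty. -/
structure WFA (R : Type*) extends MatrixFamily R where
  init : Fin dim → R
  final : Fin dim → R

/-! ### Infinite words, word products, stability, RCP sets -/

/-- The prefix of length `k` of an infinite word. -/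
def wordPrefix {σ : Type*} (w : ℕ → σ) (k : ℕ) : List σ :=
  (List.range k).map w

namespace MatrixFamily

variable {R S : Type*}

/-- Entrywise image of a family. -/
def map (f : R → S) (B : MatrixFamily R) : MatrixFamily S where
  letters := B.letters
  dim := B.dim
  mat a := (B.mat a).map f

/-- `A_v = A_{v₁} A_{v₂} ⋯ A_{v_k}`, and the identity matrix for the empty word. -/
def wordProd [Semiring R] (B : MatrixFamily R) (v : List (Fin B.letters)) :
    Matrix (Fin B.dim) (Fin B.dim) R :=
  (v.map B.mat).prod

/-- `A_w` exists and equals `L`, for the infinite word `w`. -/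
def HasLimit (B : MatrixFamily ℝ) (w : ℕ → Fin B.letters)
    (L : Matrix (Fin B.dim) (Fin B.dim) ℝ) : Prop :=
  Tendsto (fun k => B.wordProd (wordPrefix w k)) atTop (𝓝 L)

/-- Stability: `A_w = 0` for all infinite words `w`. -/
def IsStable (B : MatrixFamily ℝ) : Prop :=
  ∀ w : ℕ → Fin B.letters, B.HasLimit w 0

/-- Continuous RCP set: `A_w` is defined for all infinite words `w` and depends continuously
on `w`. The topology on `ℕ → Fin letters` is the product of the discrete topologies, which is
the topology of the Cantor (prefix) metric. -/
def IsContinuousRCP (B : MatrixFamily ℝ) : Prop :=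
  ∃ L : (ℕ → Fin B.letters) → Matrix (Fin B.dim) (Fin B.dim) ℝ,
    (∀ w, B.HasLimit w (L w)) ∧ Continuous L

/-- The family of block matrices `[[B_a, b_a], [0, 1]]`. -/
def bordered [Zero R] [One R] (B : MatrixFamily R) (b : Fin B.letters → Fin B.dim → R) :
    MatrixFamily R where
  letters := B.letters
  dim := B.dim + 1
  mat a := Matrix.reindex finSumFinEquiv finSumFinEquiv
    (Matrix.fromBlocks (B.mat a) (Matrix.of fun i (_ : Fin 1) => b a i) 0 1)

end MatrixFamily

/-! ### Weighted finite automata -/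

namespace WFA

variable {R S : Type*}

/-- Entrywise image of an automaton. -/
def map (f : R → S) (A : WFA R) : WFA S where
  toMatrixFamily := A.toMatrixFamily.map f
  init i := f (A.init i)
  final i := f (A.final i)

/-- The word function `F_A(v) = I A_v F`. -/
def wordFunction [Semiring R] (A : WFA R) (v : List (Fin A.letters)) : R :=
  A.init ⬝ᵥ (A.wordProd v).mulVec A.final

/-- The two automata have the same alphabet and compute the same word function. -/
def SameWordFunction [Semiring R] (A B : WFA R) : Prop :=
  ∃ h : A.letters = B.letters,
    ∀ v : List (Fin A.letters), B.wordFunction (v.map (Fin.cast h)) = A.wordFunction v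

/-- Average preserving: `∑_a A_a F = |Σ| F`. -/
def IsAveragePreserving [Semiring R] (A : WFA R) : Prop :=
  ∑ a, (A.mat a).mulVec A.final = A.letters • A.final

/-- Left minimal: the vectors `I A_u` span a space whose dimension is the number of states. -/
def IsLeftMinimal [Field R] (A : WFA R) : Prop :=
  Module.finrank R (Submodule.span R
    (Set.range fun u : List (Fin A.letters) => Matrix.vecMul A.init (A.wordProd u))) = A.dim

/-- Right minimal: the vectors `A_u F` span a space whose dimension is the number of states. -/
def IsRightMinimal [Field R] (A : WFA R) : Prop :=
  Module.finrank R (Submodule.span R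
    (Set.range fun u : List (Fin A.letters) => (A.wordProd u).mulVec A.final)) = A.dim

/-- Minimal: left minimal and right minimal. -/
def IsMinimal [Field R] (A : WFA R) : Prop :=
  A.IsLeftMinimal ∧ A.IsRightMinimal

/-- `f_A(w) = lim F_A(pref_k(w))` exists and equals `y`. -/
def HasOmegaValue (A : WFA ℝ) (w : ℕ → Fin A.letters) (y : ℝ) : Prop :=
  Tendsto (fun k => A.wordFunction (wordPrefix w k)) atTop (𝓝 y)

/-- The `ω`-function `f_A` is defined and continuous on the whole space of infinite words. -/
def OmegaContinuous (A : WFA ℝ) : Prop :=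
  ∃ f : (ℕ → Fin A.letters) → ℝ, (∀ w, A.HasOmegaValue w (f w)) ∧ Continuous f

/-- The `ω`-function `f_A` is everywhere defined and zero. -/
def OmegaZero (A : WFA ℝ) : Prop :=
  ∀ w : ℕ → Fin A.letters, A.HasOmegaValue w 0

/-- Change of basis: `I M`, `M⁻¹ A_a M`, `M⁻¹ F` (meant for invertible `M`). -/
noncomputable def changeBasis [Field R] (A : WFA R) (M : Matrix (Fin A.dim) (Fin A.dim) R) :
    WFA R where
  letters := A.letters
  dim := A.dim
  mat a := M⁻¹ * A.mat a * M
  init := Matrix.vecMul A.init M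
  final := M⁻¹.mulVec A.final

/-- `C` arises from `A` by a change of basis, and its weight matrices are
`[[B_a, b_a], [0, 1]]` for some column vectors `b_a`. -/
def IsCanonicalForm [Field R] (A C : WFA R) (B : MatrixFamily R) : Prop :=
  (∃ M : Matrix (Fin A.dim) (Fin A.dim) R, IsUnit M.det ∧ C = A.changeBasis M) ∧
  ∃ b : Fin B.letters → Fin B.dim → R, C.toMatrixFamily = B.bordered b

/-- There is a nonzero row vector `I_c` with `I_c A_a = I_c` for all letters `a`. -/
def HasCommonFixedRow [Semiring R] (A : WFA R) : Prop :=
  ∃ c : Fin A.dim → R, c ≠ 0 ∧ ∀ a, Matrix.vecMul c (A.mat a) = c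

end WFA

/-! ### Codes for finite families and automata

A family is coded by the number of letters, the size and the list of all entries. -/

/-- Pairs `(p, x)` with `x` a tuple of length `N p` are lists of a prescribed length. -/
def sigmaTupleEquiv {P K : Type*} (N : P → ℕ) :
    (Σ p : P, Fin (N p) → K) ≃ {x : P × List K // x.2.length = N x.1} where
  toFun s := ⟨(s.1, List.ofFn s.2), by simp⟩
  invFun x := ⟨x.1.1, fun i => x.1.2.get (Fin.cast x.2.symm i)⟩
  left_inv := by
    rintro ⟨p, f⟩
    simp only [List.get_ofFn]
    rfl
  right_inv := by
    rintro ⟨⟨p, l⟩, h⟩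
    apply Subtype.ext
    apply Prod.ext
    · rfl
    · apply List.ext_get
      · simpa using h.symm
      · intro i h1 h2
        simp

/-- The coding of `Σ p, (Fin (N p) → K)`, for a primitive recursive `N`. -/
@[reducible]
def sigmaTuplePrimcodable {P K : Type*} [Primcodable P] [Primcodable K] (N : P → ℕ)
    (hN : Primrec N) : Primcodable (Σ p : P, Fin (N p) → K) :=
  letI : Primcodable {x : P × List K // x.2.length = N x.1} :=
    Primcodable.subtype
      (Primrec.eq.comp (Primrec.list_length.comp Primrec.snd) (hN.comp Primrec.fst))
  Primcodable.ofEquiv _ (sigmaTupleEquiv N)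

/-- The entries of `k` matrices of size `n × n`, as one tuple. -/
def entriesEquiv (K : Type*) (k n : ℕ) :
    (Fin k → Matrix (Fin n) (Fin n) K) ≃ (Fin (k * (n * n)) → K) :=
  ((Equiv.refl (Fin k)).arrowCongr (Equiv.curry (Fin n) (Fin n) K).symm).trans
    ((Equiv.curry (Fin k) (Fin n × Fin n) K).symm.trans
      ((((Equiv.refl (Fin k)).prodCongr finProdFinEquiv).trans finProdFinEquiv).arrowCongr
        (Equiv.refl K)))

/-- A family as the pair (number of letters, size) and the tuple of its entries. -/
def MatrixFamily.codeEquiv (K : Type*) :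
    MatrixFamily K ≃ Σ p : ℕ × ℕ, Fin (p.1 * (p.2 * p.2)) → K where
  toFun B := ⟨(B.letters, B.dim), entriesEquiv K _ _ B.mat⟩
  invFun s := ⟨s.1.1, s.1.2, (entriesEquiv K _ _).symm s.2⟩
  left_inv B := by simp
  right_inv s := by simp

/-- An automaton as the pair (number of letters, number of states) and the tuple of the entries
of `I`, of `F` and of the weight matrices. -/
def WFA.codeEquiv (K : Type*) :
    WFA K ≃ Σ p : ℕ × ℕ, Fin (p.2 + p.2 + p.1 * (p.2 * p.2)) → K where
  toFun A := ⟨(A.letters, A.dim),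
    Fin.append (Fin.append A.init A.final) (entriesEquiv K _ _ A.mat)⟩
  invFun s :=
    { letters := s.1.1
      dim := s.1.2
      mat := (entriesEquiv K _ _).symm fun i => s.2 (Fin.natAdd _ i)
      init := fun i => s.2 (Fin.castAdd _ (Fin.castAdd _ i))
      final := fun i => s.2 (Fin.castAdd _ (Fin.natAdd _ i)) }
  left_inv A := by
    obtain ⟨⟨k, n, M⟩, I, F⟩ := A
    have h : (fun i => Fin.append (Fin.append I F) (entriesEquiv K k n M)
        (Fin.natAdd (n + n) i)) = entriesEquiv K k n M := by
      funext i
      rw [Fin.append_right]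
    simp only [Fin.append_left, Fin.append_right]
    rw [h, Equiv.symm_apply_apply]
  right_inv := by
    rintro ⟨p, f⟩
    simp only [Equiv.apply_symm_apply]
    congr 1
    funext i
    refine Fin.addCases (fun i => ?_) (fun i => ?_) i
    · refine Fin.addCases (fun i => ?_) (fun i => ?_) i <;>
        simp only [Fin.append_left, Fin.append_right]
    · simp only [Fin.append_right]

instance MatrixFamily.primcodable {K : Type*} [Primcodable K] : Primcodable (MatrixFamily K) :=
  letI := sigmaTuplePrimcodable (K := K) (fun p : ℕ × ℕ => p.1 * (p.2 * p.2))
    (Primrec.nat_mul.comp Primrec.fst (Primrec.nat_mul.comp Primrec.snd Primrec.snd))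
  Primcodable.ofEquiv _ (MatrixFamily.codeEquiv K)

instance WFA.primcodable {K : Type*} [Primcodable K] : Primcodable (WFA K) :=
  letI := sigmaTuplePrimcodable (K := K) (fun p : ℕ × ℕ => p.2 + p.2 + p.1 * (p.2 * p.2))
    (Primrec.nat_add.comp (Primrec.nat_add.comp Primrec.snd Primrec.snd)
      (Primrec.nat_mul.comp Primrec.fst (Primrec.nat_mul.comp Primrec.snd Primrec.snd)))
  Primcodable.ofEquiv _ (WFA.codeEquiv K)

/-! ### Decision problems and reductions -/

/-- The elements of `K` can be added, multiplied and divided algorithmically. (Equality is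
decidable on codes, because `Primcodable` codes are unique.) -/
structure EffectiveArithmetic (K : Subfield ℝ) [Primcodable K] : Prop where
  add : Computable₂ fun x y : K => x + y
  mul : Computable₂ fun x y : K => x * y
  div : Computable₂ fun x y : K => x / y

/-- A decision problem: the admissible inputs, and the question asked about them. -/
structure DecisionProblem (α : Type*) where
  input : α → Prop
  question : α → Prop

/-- Algorithmic (many-one) reducibility: a computable map takes every admissible input of `P` to
an admissible input of `Q` with the same answer. -/
def DecisionProblem.ReducibleTo {α β : Type*} [Primcodable α] [Primcodable β]
    (P : DecisionProblem α) (Q : DecisionProblem β) : Prop :=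
  ∃ g : α → β, Computable g ∧
    ∀ x, P.input x → Q.input (g x) ∧ (P.question x ↔ Q.question (g x))

/-- The family with entries in `K`, seen as a family of real matrices. -/
def MatrixFamily.toReal {K : Subfield ℝ} (B : MatrixFamily K) : MatrixFamily ℝ :=
  B.map fun x : K => (x : ℝ)

/-- The automaton with weights in `K`, seen as an automaton over `ℝ`. -/
def WFA.toReal {K : Subfield ℝ} (A : WFA K) : WFA ℝ :=
  A.map fun x : K => (x : ℝ)

/-- Input: a nonempty finite set of square matrices. Question: is it stable? -/
def matrixProductStability (K : Subfield ℝ) : DecisionProblem (MatrixFamily K) where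
  input B := 0 < B.letters
  question B := B.toReal.IsStable

/-- Input: a nonempty finite set of square matrices. Question: is it a continuous RCP set? -/
def matrixProductContinuity (K : Subfield ℝ) : DecisionProblem (MatrixFamily K) where
  input B := 0 < B.letters
  question B := B.toReal.IsContinuousRCP

/-- Input: an average preserving automaton (with a nonempty alphabet). Question: is its
`ω`-function everywhere continuous? -/
def apWFAContinuity (K : Subfield ℝ) : DecisionProblem (WFA K) where
  input A := 0 < A.letters ∧ A.toReal.IsAveragePreserving
  question A := A.toReal.OmegaContinuous

/-! Continuity is governed by the columns of the matrices `A_a - 1`. Let `L(w)` be the limits of a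
continuous RCP set. The words `pref_k(w) a^ω` tend to `w`, so `L(w) = L(w) L(a^ω)`, and `L(a^ω)`
absorbs `A_a`; hence `L(w) A_a = L(w)` (`MatrixFamily.mul_mat_eq_of_hasLimit`). Thus every `L(w)`
kills the span `V` of all columns of the `A_a - 1`, a common invariant subspace, and the action of
the family on `V` is stable (`IsContinuousRCP.isStable_of_conj`). Conversely, by compactness of the
word space a stable family contracts exponentially (`IsStable.exists_geometric_bound`). If the
action on an invariant subspace containing these columns is stable, the increments `A_v (A_a - 1)`
are therefore exponentially small and the products converge uniformly (`isContinuousRCP_of_factor`).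
This reduces Matrix Product Continuity to stability of the action on `V`
(`IsIncrementReduction.isContinuousRCP_iff`).

In an average preserving automaton, `F_A(v)` is the average of the `F_A(va)`, so it lies between two
values of `f_A` on words starting with `v`. If `f_A` is continuous, `F_A(u pref_k(w) v)` therefore
tends to `f_A(uw)` for every fixed `v` (`IsAveragePreserving.tendsto_of_continuous`), and by
minimality and bilinearity the weight matrices form a continuous RCP set. The same sandwich shows
that `f_A = 0` forces `F_A = 0`, so the zero test on a minimal automaton merely asks whether there
are no states. Right minimality makes the space of common fixed rows at most one-dimensional. If it
is spanned by `c ≠ 0`, the rows of `L(w)` are multiples of `c`, and continuity is equivalent to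
stability on the kernel of `c`, where the blocks `B_a` act
(`IsMinimal.omegaContinuous_iff_isStable`). If there is no nonzero fixed row, `V` is the whole
space, and continuity gives `L(w) = 0` and `f_A = 0`.

Computability comes from unbounded search (`ComputablePred.exists_computable_choice`): linear
algebra proves that the desired object exists together with a certificate made of matrix identities,
and such a certificate can be checked. Minimality is certified by lists of reachable rows with a
left inverse; the absence of a fixed row by matrices `X_a` with `∑ (A_a - 1) X_a = 1`, which is
precisely the alternative to a canonical form. Identities over `K` persist over the reals, so
objects found over `K` answer the real questions. -/

/-! ### Closure properties of computable functions and predicates -/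

namespace ComputablePred

variable {α β : Type*} [Primcodable α] [Primcodable β]

theorem comp {p : β → Prop} (hp : ComputablePred p) {g : α → β} (hg : Computable g) :
    ComputablePred fun a => p (g a) := by
  obtain ⟨f, hf, rfl⟩ := computable_iff.1 hp
  exact computable_iff.2 ⟨fun a => f (g a), hf.comp hg, rfl⟩

theorem and {p q : α → Prop} (hp : ComputablePred p) (hq : ComputablePred q) :
    ComputablePred fun a => p a ∧ q a := by
  obtain ⟨f, hf, rfl⟩ := computable_iff.1 hp
  obtain ⟨g, hg, rfl⟩ := computable_iff.1 hq
  refine computable_iff.2 ⟨fun a => f a && g a, Primrec.and.to_comp.comp hf hg, ?_⟩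
  funext a
  simp

theorem or {p q : α → Prop} (hp : ComputablePred p) (hq : ComputablePred q) :
    ComputablePred fun a => p a ∨ q a := by
  obtain ⟨f, hf, rfl⟩ := computable_iff.1 hp
  obtain ⟨g, hg, rfl⟩ := computable_iff.1 hq
  refine computable_iff.2 ⟨fun a => f a || g a, Primrec.or.to_comp.comp hf hg, ?_⟩
  funext a
  simp

theorem eq {f g : α → β} (hf : Computable f) (hg : Computable g) :
    ComputablePred fun a => f a = g a := by
  classical
  exact ComputablePred.comp (p := fun x : β × β => x.1 = x.2)
    ⟨inferInstance, (Primrec.eq (α := β)).decide.to_comp⟩ (hf.pair hg)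

theorem lt {f g : α → ℕ} (hf : Computable f) (hg : Computable g) :
    ComputablePred fun a => f a < g a :=
  ComputablePred.comp (p := fun x : ℕ × ℕ => x.1 < x.2)
    ⟨inferInstance, Primrec.nat_lt.decide.to_comp⟩ (hf.pair hg)

theorem ball_lt {n : α → ℕ} (hn : Computable n) {p : α → ℕ → Prop}
    (hp : ComputablePred fun x : α × ℕ => p x.1 x.2) :
    ComputablePred fun a => ∀ i < n a, p a i := by
  obtain ⟨f, hf, hpf⟩ := computable_iff.1 hp
  have hpf' : ∀ a i, p a i ↔ f (a, i) = true := fun a i => by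
    simpa using congrFun hpf (a, i)
  refine computable_iff.2 ⟨fun a => Nat.rec true (fun i b => b && f (a, i)) (n a),
    Computable.nat_rec hn (Computable.const true) (h := fun a y => y.2 && f (a, y.1)) ?_, ?_⟩
  · exact Primrec.and.to_comp.comp (Computable.snd.comp Computable.snd)
      (hf.comp (Computable.fst.pair (Computable.fst.comp Computable.snd)))
  · funext a
    simp only [hpf', eq_iff_iff]
    induction n a with
    | zero => simp
    | succ k ih =>
      rw [Nat.forall_lt_succ_right, ih]
      simp

theorem bex_lt {n : α → ℕ} (hn : Computable n) {p : α → ℕ → Prop}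
    (hp : ComputablePred fun x : α × ℕ => p x.1 x.2) :
    ComputablePred fun a => ∃ i < n a, p a i :=
  (ComputablePred.not (ball_lt hn (p := fun a i => ¬ p a i) hp.not)).of_eq
    fun a => by push Not; rfl

end ComputablePred

theorem Computable.ite {α σ : Type*} [Primcodable α] [Primcodable σ] {p : α → Prop}
    [DecidablePred p] (hp : ComputablePred p) {f g : α → σ} (hf : Computable f)
    (hg : Computable g) : Computable fun a => if p a then f a else g a :=
  (Computable.cond hp.decide hf hg).of_eq fun a => by by_cases h : p a <;> simp [h]

theorem Computable.sum_range {α R : Type*} [Primcodable α] [Primcodable R] [AddCommMonoid R]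
    (hadd : Computable₂ fun x y : R => x + y) {n : α → ℕ} (hn : Computable n) {f : α × ℕ → R}
    (hf : Computable f) : Computable fun a => ∑ i ∈ Finset.range (n a), f (a, i) := by
  have h : Computable fun a => (Nat.rec 0 (fun i b => b + f (a, i)) (n a) : R) := by
    refine Computable.nat_rec hn (Computable.const 0) (h := fun a y => y.2 + f (a, y.1)) ?_
    exact hadd.comp (Computable.snd.comp Computable.snd)
      (hf.comp (Computable.fst.pair (Computable.fst.comp Computable.snd)))
  refine h.of_eq fun a => ?_
  induction n a with
  | zero => simp
  | succ k ih => simp [Finset.sum_range_succ, ih]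

/-- Unbounded search: if every `a` has a `b` passing a computable test, such a `b` can be
computed from `a`. -/
theorem ComputablePred.exists_computable_choice {α β : Type*} [Primcodable α] [Primcodable β]
    {p : α → β → Prop} (hp : ComputablePred fun x : α × β => p x.1 x.2) (h : ∀ a, ∃ b, p a b) :
    ∃ g : α → β, Computable g ∧ ∀ a, p a (g a) := by
  obtain ⟨f, hf, hpf⟩ := computable_iff.1 hp
  have hpf' : ∀ a b, p a b ↔ f (a, b) = true := fun a b => by
    simpa using congrFun hpf (a, b)
  -- Stage `n` tests the object with code `n`, if there is one.
  let F : α → ℕ → Option β := fun a n =>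
    (Encodable.decode (α := β) n).bind fun b => cond (f (a, b)) (some b) none
  have hF : Computable₂ F := by
    refine Computable.option_bind (Computable.decode.comp Computable.snd) ?_
    exact Computable.cond (hf.comp ((Computable.fst.comp Computable.fst).pair Computable.snd))
      (Computable.option_some.comp Computable.snd) (Computable.const none)
  have hdom : ∀ a, (Nat.rfindOpt (F a)).Dom := by
    intro a
    obtain ⟨b, hb⟩ := h a
    exact Nat.rfindOpt_dom.2 ⟨Encodable.encode b, b, by simp [F, (hpf' a b).1 hb]⟩
  refine ⟨fun a => (Nat.rfindOpt (F a)).get (hdom a),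
    (Partrec.rfindOpt hF).of_eq_tot fun a => Part.get_mem _, fun a => ?_⟩
  obtain ⟨n, hn⟩ := Nat.rfindOpt_spec (Part.get_mem (hdom a))
  simp only [F, Option.mem_def, Option.bind_eq_some_iff] at hn
  obtain ⟨b, -, hb⟩ := hn
  cases hfb : f (a, b) with
  | false => simp [hfb] at hb
  | true =>
    rw [hfb, cond_true, Option.some.injEq] at hb
    have := (hpf' a b).2 hfb
    rwa [hb] at this

/-! ### Computable matrices -/

/-- A matrix depending computably on a parameter: the entries are given by a computable function
of the parameter and the two indices. -/
def ComputableMatrix {α R : Type*} [Primcodable α] [Primcodable R] {n m : α → ℕ}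
    (X : ∀ a, Matrix (Fin (n a)) (Fin (m a)) R) : Prop :=
  ∃ f : α × ℕ × ℕ → R, Computable f ∧ ∀ a i j, X a i j = f (a, i, j)

namespace ComputableMatrix

variable {α β R : Type*} [Primcodable α] [Primcodable β] [Primcodable R] {n m r : α → ℕ}

theorem comp {X : ∀ a, Matrix (Fin (n a)) (Fin (m a)) R} (hX : ComputableMatrix X) {g : β → α}
    (hg : Computable g) : ComputableMatrix (n := fun b => n (g b)) (m := fun b => m (g b))
      fun b => X (g b) := by
  obtain ⟨f, hf, h⟩ := hX
  exact ⟨fun x => f (g x.1, x.2), hf.comp ((hg.comp Computable.fst).pair Computable.snd),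
    fun b i j => h _ i j⟩

theorem transpose {X : ∀ a, Matrix (Fin (n a)) (Fin (m a)) R} (hX : ComputableMatrix X) :
    ComputableMatrix fun a => (X a).transpose := by
  obtain ⟨f, hf, h⟩ := hX
  exact ⟨fun x => f (x.1, x.2.2, x.2.1), hf.comp (Computable.fst.pair
    ((Computable.snd.comp Computable.snd).pair (Computable.fst.comp Computable.snd))),
    fun b i j => h _ j i⟩

theorem add [Add R] (hadd : Computable₂ fun x y : R => x + y)
    {X Y : ∀ a, Matrix (Fin (n a)) (Fin (m a)) R} (hX : ComputableMatrix X)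
    (hY : ComputableMatrix Y) : ComputableMatrix fun a => X a + Y a := by
  obtain ⟨f, hf, hfX⟩ := hX
  obtain ⟨g, hg, hgY⟩ := hY
  exact ⟨fun x => f x + g x, hadd.comp hf hg, fun a i j => by simp [hfX, hgY]⟩

theorem one [Zero R] [One R] : ComputableMatrix (n := n) (m := n) fun _ => (1 : Matrix _ _ R) := by
  refine ⟨fun x => if x.2.1 = x.2.2 then 1 else 0, Computable.ite
    (ComputablePred.eq (Computable.fst.comp Computable.snd) (Computable.snd.comp Computable.snd))
    (Computable.const 1) (Computable.const 0), fun a i j => ?_⟩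
  simp [Matrix.one_apply, Fin.ext_iff]

theorem mul [NonUnitalNonAssocSemiring R] (hadd : Computable₂ fun x y : R => x + y)
    (hmul : Computable₂ fun x y : R => x * y) (hm : Computable m)
    {X : ∀ a, Matrix (Fin (n a)) (Fin (m a)) R} {Y : ∀ a, Matrix (Fin (m a)) (Fin (r a)) R}
    (hX : ComputableMatrix X) (hY : ComputableMatrix Y) :
    ComputableMatrix fun a => X a * Y a := by
  obtain ⟨f, hf, hfX⟩ := hX
  obtain ⟨g, hg, hgY⟩ := hY
  refine ⟨fun x => ∑ l ∈ Finset.range (m x.1), f (x.1, x.2.1, l) * g (x.1, l, x.2.2),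
    Computable.sum_range hadd (hm.comp Computable.fst)
      (f := fun y : (α × ℕ × ℕ) × ℕ => f (y.1.1, y.1.2.1, y.2) * g (y.1.1, y.2, y.1.2.2))
      (hmul.comp (hf.comp ?_) (hg.comp ?_)), fun a i j => ?_⟩
  · exact (Computable.fst.comp Computable.fst).pair
      ((Computable.fst.comp (Computable.snd.comp Computable.fst)).pair Computable.snd)
  · exact (Computable.fst.comp Computable.fst).pair
      (Computable.snd.pair (Computable.snd.comp (Computable.snd.comp Computable.fst)))
  · simp only [Matrix.mul_apply, hfX, hgY]
    exact Fin.sum_univ_eq_sum_range (fun l => f (a, i, l) * g (a, l, j)) _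

theorem sum_range [AddCommMonoid R] (hadd : Computable₂ fun x y : R => x + y) {k : α → ℕ}
    (hk : Computable k) {X : ∀ a, ℕ → Matrix (Fin (n a)) (Fin (m a)) R}
    (hX : ComputableMatrix (n := fun x => n x.1) (m := fun x => m x.1)
      fun x : α × ℕ => X x.1 x.2) :
    ComputableMatrix fun a => ∑ l ∈ Finset.range (k a), X a l := by
  obtain ⟨f, hf, hfX⟩ := hX
  refine ⟨fun x => ∑ l ∈ Finset.range (k x.1), f ((x.1, l), x.2), Computable.sum_range hadd
    (hk.comp Computable.fst) (f := fun y : (α × ℕ × ℕ) × ℕ => f ((y.1.1, y.2), y.1.2))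
    (hf.comp ?_), fun a i j => ?_⟩
  · exact ((Computable.fst.comp Computable.fst).pair Computable.snd).pair
      (Computable.snd.comp Computable.fst)
  · refine (Matrix.sum_apply i j _ _).trans ?_
    exact Finset.sum_congr rfl fun l _ => hfX (a, l) i j

theorem eq {X Y : ∀ a, Matrix (Fin (n a)) (Fin (m a)) R} (hn : Computable n) (hm : Computable m)
    (hX : ComputableMatrix X) (hY : ComputableMatrix Y) :
    ComputablePred fun a => X a = Y a := by
  obtain ⟨f, hf, hfX⟩ := hX
  obtain ⟨g, hg, hgY⟩ := hY
  have h : ComputablePred fun x : (α × ℕ) × ℕ =>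
      f (x.1.1, x.1.2, x.2) = g (x.1.1, x.1.2, x.2) :=
    have hr : Computable fun x : (α × ℕ) × ℕ => (x.1.1, x.1.2, x.2) :=
      (Computable.fst.comp Computable.fst).pair
        ((Computable.snd.comp Computable.fst).pair Computable.snd)
    ComputablePred.eq (hf.comp hr) (hg.comp hr)
  refine (ComputablePred.ball_lt hn (p := fun a i => ∀ j < m a, f (a, i, j) = g (a, i, j))
    (ComputablePred.ball_lt (hm.comp Computable.fst)
      (p := fun y j => f (y.1, y.2, j) = g (y.1, y.2, j)) h)).of_eq fun a => ?_
  rw [← Matrix.ext_iff]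
  simp only [hfX, hgY]
  exact ⟨fun h i j => h i i.2 j j.2, fun h i hi j hj => h ⟨i, hi⟩ ⟨j, hj⟩⟩

end ComputableMatrix

/-! ### Matrices given by lists, entries of families and automata -/

/-- The matrix whose rows are listed, filled up with zeros. -/
def Matrix.ofLists {R : Type*} [Zero R] (n m : ℕ) (l : List (List R)) :
    Matrix (Fin n) (Fin m) R :=
  fun i j => (l.getD i []).getD j 0

/-- Lets a search for a matrix of unknown size run over nested lists, a single coded type that does
not depend on the dimensions. -/
theorem Matrix.exists_ofLists {R : Type*} [Zero R] {n m : ℕ} (X : Matrix (Fin n) (Fin m) R) :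
    ∃ l, Matrix.ofLists n m l = X := by
  refine ⟨List.ofFn fun i => List.ofFn (X i), ?_⟩
  ext i j
  simp [Matrix.ofLists]

theorem Matrix.exists_ofLists_family {R : Type*} [Zero R] {k n m : ℕ}
    (X : Fin k → Matrix (Fin n) (Fin m) R) :
    ∃ l : List (List (List R)), ∀ a : Fin k, Matrix.ofLists n m (l.getD a []) = X a := by
  choose f hf using fun a => Matrix.exists_ofLists (X a)
  exact ⟨List.ofFn f, fun a => by simp [hf]⟩

theorem ComputableMatrix.ofLists {α R : Type*} [Primcodable α] [Primcodable R] [Zero R]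
    {n m : α → ℕ} {l : α → List (List R)} (hl : Computable l) :
    ComputableMatrix fun a => Matrix.ofLists (n a) (m a) (l a) :=
  ⟨fun x => ((l x.1).getD x.2.1 []).getD x.2.2 0,
    (Primrec.list_getD (0 : R)).to_comp.comp
      ((Primrec.list_getD ([] : List R)).to_comp.comp (hl.comp Computable.fst)
        (Computable.fst.comp Computable.snd)) (Computable.snd.comp Computable.snd),
    fun _ _ _ => rfl⟩

theorem Computable.list_getD {α σ : Type*} [Primcodable α] [Primcodable σ] {l : α → List σ}
    {i : α → ℕ} (d : σ) (hl : Computable l) (hi : Computable i) :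
    Computable fun a => (l a).getD (i a) d :=
  (Primrec.list_getD d).to_comp.comp hl hi

/-- The weight matrix of the letter with number `a`, or zero if there is none. -/
def MatrixFamily.matAt {R : Type*} [Zero R] (B : MatrixFamily R) (a : ℕ) :
    Matrix (Fin B.dim) (Fin B.dim) R :=
  if h : a < B.letters then B.mat ⟨a, h⟩ else 0

theorem MatrixFamily.matAt_coe {R : Type*} [Zero R] (B : MatrixFamily R) (a : Fin B.letters) :
    B.matAt a = B.mat a := by
  simp [MatrixFamily.matAt]

theorem sigmaTuple_primrec {P K : Type*} [Primcodable P] [Primcodable K] (N : P → ℕ)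
    (hN : Primrec N) :
    letI := sigmaTuplePrimcodable (K := K) N hN
    Primrec fun s : Σ p : P, Fin (N p) → K => (s.1, List.ofFn s.2) := by
  let : Primcodable {x : P × List K // x.2.length = N x.1} :=
    Primcodable.subtype
      (Primrec.eq.comp (Primrec.list_length.comp Primrec.snd) (hN.comp Primrec.fst))
  let := sigmaTuplePrimcodable (K := K) N hN
  exact Primrec.subtype_val.comp (Primrec.of_equiv (e := sigmaTupleEquiv (K := K) N))

/-- Makes the row-major position of an entry explicit, so that entries can be read off the coded
list by index arithmetic. -/
theorem entriesEquiv_apply (K : Type*) (k n : ℕ) (M : Fin k → Matrix (Fin n) (Fin n) K)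
    (a : Fin k) (i j : Fin n) (h : (j + n * i) + n * n * a < k * (n * n)) :
    entriesEquiv K k n M ⟨(j + n * i) + n * n * a, h⟩ = M a i j := by
  have : (⟨(j + n * i) + n * n * a, h⟩ : Fin (k * (n * n))) =
      finProdFinEquiv (a, finProdFinEquiv (i, j)) := by
    ext
    simp [finProdFinEquiv]
  rw [this]
  change M (finProdFinEquiv.symm (finProdFinEquiv (a, finProdFinEquiv (i, j)))).1
    (finProdFinEquiv.symm (finProdFinEquiv.symm (finProdFinEquiv (a, finProdFinEquiv (i, j)))).2).1
    (finProdFinEquiv.symm (finProdFinEquiv.symm (finProdFinEquiv (a, finProdFinEquiv (i, j)))).2).2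
    = M a i j
  simp only [Equiv.symm_apply_apply]

theorem entry_index_lt {k n : ℕ} (a : Fin k) (i j : Fin n) :
    (j + n * i : ℕ) + n * n * a < k * (n * n) := by
  have := (finProdFinEquiv (a, finProdFinEquiv (i, j))).2
  simpa [finProdFinEquiv] using this

namespace MatrixFamily

variable {K : Type*} [Primcodable K]

theorem primrec_code : Primrec fun B : MatrixFamily K =>
    ((B.letters, B.dim), List.ofFn (entriesEquiv K _ _ B.mat)) := by
  let := sigmaTuplePrimcodable (K := K) (fun p : ℕ × ℕ => p.1 * (p.2 * p.2))
    (Primrec.nat_mul.comp Primrec.fst (Primrec.nat_mul.comp Primrec.snd Primrec.snd))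
  exact (sigmaTuple_primrec (K := K) (fun p : ℕ × ℕ => p.1 * (p.2 * p.2))
    (Primrec.nat_mul.comp Primrec.fst (Primrec.nat_mul.comp Primrec.snd Primrec.snd))).comp
      (Primrec.of_equiv (e := MatrixFamily.codeEquiv K))

theorem computable_letters : Computable (MatrixFamily.letters (R := K)) :=
  (Primrec.fst.comp (Primrec.fst.comp primrec_code)).to_comp

theorem computable_dim : Computable (MatrixFamily.dim (R := K)) :=
  (Primrec.snd.comp (Primrec.fst.comp primrec_code)).to_comp

theorem computable_matAt [Zero K] : ComputableMatrix (n := fun x => x.1.dim)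
    (m := fun x => x.1.dim) fun x : MatrixFamily K × ℕ => x.1.matAt x.2 := by
  have hdim : Primrec (MatrixFamily.dim (R := K)) :=
    Primrec.snd.comp (Primrec.fst.comp primrec_code)
  have hdim' : Primrec fun x : (MatrixFamily K × ℕ) × ℕ × ℕ => x.1.1.dim :=
    hdim.comp (Primrec.fst.comp Primrec.fst)
  refine ⟨fun x => if x.1.2 < x.1.1.letters then (List.ofFn (entriesEquiv K _ _ x.1.1.mat)).getD
    ((x.2.2 + x.1.1.dim * x.2.1) + x.1.1.dim * x.1.1.dim * x.1.2) 0 else 0,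
    Computable.ite ?_ (Computable.list_getD _ ?_ ?_) (Computable.const 0), ?_⟩
  · exact ComputablePred.lt (Computable.snd.comp Computable.fst)
      (computable_letters.comp (Computable.fst.comp Computable.fst))
  · exact (Primrec.snd.comp primrec_code).to_comp.comp (Computable.fst.comp Computable.fst)
  · exact (Primrec.nat_add.comp (Primrec.nat_add.comp (Primrec.snd.comp Primrec.snd)
      (Primrec.nat_mul.comp hdim' (Primrec.fst.comp Primrec.snd)))
      (Primrec.nat_mul.comp (Primrec.nat_mul.comp hdim' hdim')
        (Primrec.snd.comp Primrec.fst))).to_comp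
  · rintro ⟨B, a⟩ i j
    by_cases h : a < B.letters
    · have h1 := entry_index_lt ⟨a, h⟩ i j
      simp only [matAt, h, dif_pos, if_true]
      rw [List.getD_eq_getElem _ _ (by simpa using h1), List.getElem_ofFn]
      exact (entriesEquiv_apply K _ _ B.mat ⟨a, h⟩ i j h1).symm
    · simp [matAt, h]

end MatrixFamily

namespace WFA

variable {K : Type*} [Primcodable K]

theorem primrec_code : Primrec fun A : WFA K =>
    ((A.letters, A.dim), List.ofFn
      (Fin.append (Fin.append A.init A.final) (entriesEquiv K _ _ A.mat))) := by
  have hN : Primrec fun p : ℕ × ℕ => p.2 + p.2 + p.1 * (p.2 * p.2) :=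
    Primrec.nat_add.comp (Primrec.nat_add.comp Primrec.snd Primrec.snd)
      (Primrec.nat_mul.comp Primrec.fst (Primrec.nat_mul.comp Primrec.snd Primrec.snd))
  let := sigmaTuplePrimcodable (K := K) _ hN
  exact (sigmaTuple_primrec (K := K) _ hN).comp (Primrec.of_equiv (e := WFA.codeEquiv K))

theorem computable_letters : Computable fun A : WFA K => A.letters :=
  (Primrec.fst.comp (Primrec.fst.comp primrec_code)).to_comp

theorem primrec_dim : Primrec fun A : WFA K => A.dim :=
  Primrec.snd.comp (Primrec.fst.comp primrec_code)

theorem computable_dim : Computable fun A : WFA K => A.dim :=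
  primrec_dim.to_comp

theorem computable_matAt [Zero K] : ComputableMatrix (n := fun x => x.1.dim)
    (m := fun x => x.1.dim) fun x : WFA K × ℕ => x.1.matAt x.2 := by
  have hdim' : Primrec fun x : (WFA K × ℕ) × ℕ × ℕ => x.1.1.dim :=
    primrec_dim.comp (Primrec.fst.comp Primrec.fst)
  refine ⟨fun x => if x.1.2 < x.1.1.letters then (List.ofFn
      (Fin.append (Fin.append x.1.1.init x.1.1.final) (entriesEquiv K _ _ x.1.1.mat))).getD
    ((x.1.1.dim + x.1.1.dim) +
      ((x.2.2 + x.1.1.dim * x.2.1) + x.1.1.dim * x.1.1.dim * x.1.2)) 0 else 0,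
    Computable.ite ?_ (Computable.list_getD _ ?_ ?_) (Computable.const 0), ?_⟩
  · exact ComputablePred.lt (Computable.snd.comp Computable.fst)
      (computable_letters.comp (Computable.fst.comp Computable.fst))
  · exact (Primrec.snd.comp primrec_code).to_comp.comp (Computable.fst.comp Computable.fst)
  · exact (Primrec.nat_add.comp (Primrec.nat_add.comp hdim' hdim')
      (Primrec.nat_add.comp (Primrec.nat_add.comp (Primrec.snd.comp Primrec.snd)
      (Primrec.nat_mul.comp hdim' (Primrec.fst.comp Primrec.snd)))
      (Primrec.nat_mul.comp (Primrec.nat_mul.comp hdim' hdim')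
        (Primrec.snd.comp Primrec.fst)))).to_comp
  · rintro ⟨A, a⟩ i j
    by_cases h : a < A.letters
    · have h1 := entry_index_lt ⟨a, h⟩ i j
      simp only [MatrixFamily.matAt, h, dif_pos, if_true]
      rw [List.getD_eq_getElem _ _ (by rw [List.length_ofFn]; exact Nat.add_lt_add_left h1 _), List.getElem_ofFn]
      exact ((Fin.append_right (Fin.append A.init A.final) (entriesEquiv K _ _ A.mat)
        ⟨_, h1⟩).trans (entriesEquiv_apply K _ _ A.mat ⟨a, h⟩ i j h1)).symm
    · simp [MatrixFamily.matAt, h]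

/-- The initial distribution as a matrix with one row. -/
def initRow {R : Type*} (A : WFA R) : Matrix (Fin 1) (Fin A.dim) R :=
  Matrix.of fun _ j => A.init j

/-- The final distribution as a matrix with one column. -/
def finalCol {R : Type*} (A : WFA R) : Matrix (Fin A.dim) (Fin 1) R :=
  Matrix.of fun i _ => A.final i

theorem computable_initRow [Zero K] : ComputableMatrix (n := fun _ => 1) (m := fun A => A.dim)
    fun A : WFA K => A.initRow := by
  refine ⟨fun x => (List.ofFn (Fin.append (Fin.append x.1.init x.1.final)
    (entriesEquiv K _ _ x.1.mat))).getD x.2.2 0, Computable.list_getD _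
      ((Primrec.snd.comp primrec_code).to_comp.comp Computable.fst)
      (Computable.snd.comp Computable.snd), fun A i j => ?_⟩
  simp only []
  rw [List.getD_eq_getElem _ _ (by simp; omega), List.getElem_ofFn]
  exact ((Fin.append_left _ _ (Fin.castAdd _ j)).trans (Fin.append_left _ _ j)).symm

theorem computable_finalCol [Zero K] : ComputableMatrix (n := fun A => A.dim) (m := fun _ => 1)
    fun A : WFA K => A.finalCol := by
  refine ⟨fun x => (List.ofFn (Fin.append (Fin.append x.1.init x.1.final)
    (entriesEquiv K _ _ x.1.mat))).getD (x.1.dim + x.2.1) 0, Computable.list_getD _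
      ((Primrec.snd.comp primrec_code).to_comp.comp Computable.fst)
      (Primrec.nat_add.to_comp.comp (computable_dim.comp Computable.fst)
        (Computable.fst.comp Computable.snd)), fun A i j => ?_⟩
  simp only []
  rw [List.getD_eq_getElem _ _ (by simp; omega), List.getElem_ofFn]
  exact ((Fin.append_left _ _ (Fin.natAdd _ i)).trans (Fin.append_right _ _ i)).symm

end WFA

/-! ### The sum of the absolute values of the entries -/

/-- The sum of the absolute values of the entries, a submultiplicative norm. -/
def Matrix.absSum {n m : ℕ} (X : Matrix (Fin n) (Fin m) ℝ) : ℝ :=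
  ∑ i, ∑ j, |X i j|

namespace Matrix

variable {n m r : ℕ}

theorem absSum_nonneg (X : Matrix (Fin n) (Fin m) ℝ) : 0 ≤ X.absSum :=
  Finset.sum_nonneg fun _ _ => Finset.sum_nonneg fun _ _ => abs_nonneg _

theorem abs_apply_le_absSum (X : Matrix (Fin n) (Fin m) ℝ) (i : Fin n) (j : Fin m) :
    |X i j| ≤ X.absSum :=
  (Finset.single_le_sum (f := fun j => |X i j|) (fun _ _ => abs_nonneg _)
    (Finset.mem_univ j)).trans
    (Finset.single_le_sum (f := fun i => ∑ j, |X i j|)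
      (fun _ _ => Finset.sum_nonneg fun _ _ => abs_nonneg _) (Finset.mem_univ i))

theorem absSum_mul_le (X : Matrix (Fin n) (Fin m) ℝ) (Y : Matrix (Fin m) (Fin r) ℝ) :
    (X * Y).absSum ≤ X.absSum * Y.absSum := by
  unfold absSum
  rw [Finset.sum_mul]
  refine Finset.sum_le_sum fun i _ => ?_
  calc ∑ j, |(X * Y) i j| ≤ ∑ j, ∑ l, |X i l| * |Y l j| :=
        Finset.sum_le_sum fun j _ => by
          rw [mul_apply]
          exact (Finset.abs_sum_le_sum_abs _ _).trans (by simp [abs_mul])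
    _ = ∑ l, |X i l| * ∑ j, |Y l j| := by
        rw [Finset.sum_comm]
        simp [Finset.mul_sum]
    _ ≤ (∑ l, |X i l|) * ∑ l, ∑ j, |Y l j| := by
        rw [Finset.sum_mul]
        refine Finset.sum_le_sum fun l _ => mul_le_mul_of_nonneg_left ?_ (abs_nonneg _)
        exact Finset.single_le_sum (f := fun l => ∑ j, |Y l j|)
          (fun _ _ => Finset.sum_nonneg fun _ _ => abs_nonneg _) (Finset.mem_univ l)

theorem continuous_absSum : Continuous (absSum : Matrix (Fin n) (Fin m) ℝ → ℝ) :=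
  continuous_finsetSum _ fun i _ => continuous_finsetSum _ fun j _ =>
    (continuous_id.matrix_elem i j).abs

theorem absSum_zero : absSum (0 : Matrix (Fin n) (Fin m) ℝ) = 0 := by
  simp [absSum]

theorem tendsto_iff_entries {ι : Type*} {l : Filter ι} {f : ι → Matrix (Fin n) (Fin m) ℝ}
    {L : Matrix (Fin n) (Fin m) ℝ} :
    Tendsto f l (𝓝 L) ↔ ∀ i j, Tendsto (fun k => f k i j) l (𝓝 (L i j)) := by
  refine tendsto_pi_nhds.trans (forall_congr' fun i => ?_)
  exact tendsto_pi_nhds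

end Matrix

/-! ### Infinite words -/

section Words

variable {σ : Type*}

/-- The infinite word `v w`. -/
def appendWord (v : List σ) (w : ℕ → σ) : ℕ → σ :=
  v.foldr (fun a u n => Nat.casesOn n a u) w

theorem wordPrefix_succ (w : ℕ → σ) (k : ℕ) : wordPrefix w (k + 1) = wordPrefix w k ++ [w k] := by
  simp [wordPrefix, List.range_succ]

theorem wordPrefix_length (w : ℕ → σ) (k : ℕ) : (wordPrefix w k).length = k := by
  simp [wordPrefix]

theorem wordPrefix_appendWord (v : List σ) (w : ℕ → σ) (k : ℕ) :
    wordPrefix (appendWord v w) (v.length + k) = v ++ wordPrefix w k := by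
  induction v with
  | nil => simp [appendWord]
  | cons a v ih =>
    rw [List.length_cons, Nat.add_right_comm, List.cons_append, ← ih]
    simp [wordPrefix, List.range_succ_eq_map, appendWord, Function.comp_def]

theorem appendWord_apply_of_lt (v : List σ) (w : ℕ → σ) {i : ℕ} (h : i < v.length) :
    appendWord v w i = v[i] := by
  induction v generalizing i with
  | nil => simp at h
  | cons a v ih =>
    cases i with
    | zero => rfl
    | succ i => exact ih (by simpa using h)

theorem wordPrefix_getElem (w : ℕ → σ) {k i : ℕ} (h : i < (wordPrefix w k).length) :
    (wordPrefix w k)[i] = w i := by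
  simp [wordPrefix]

theorem appendWord_add (v : List σ) (w : ℕ → σ) (i : ℕ) :
    appendWord v w (v.length + i) = w i := by
  induction v with
  | nil => simp [appendWord]
  | cons a v ih =>
    rw [List.length_cons, Nat.add_right_comm, ← ih]
    rfl

theorem continuous_appendWord [TopologicalSpace σ] (v : List σ) :
    Continuous (appendWord (σ := σ) v) := by
  refine continuous_pi fun i => ?_
  rcases lt_or_ge i v.length with h | h
  · simp only [appendWord_apply_of_lt v _ h]
    exact continuous_const
  · obtain ⟨j, rfl⟩ := Nat.exists_eq_add_of_le h
    simp only [appendWord_add]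
    exact continuous_apply j

/-- Words starting with longer and longer prefixes of `w` converge to `w`. -/
theorem tendsto_appendWord_wordPrefix [TopologicalSpace σ] (w : ℕ → σ) (u : ℕ → ℕ → σ) :
    Tendsto (fun k => appendWord (wordPrefix w k) (u k)) atTop (𝓝 w) := by
  refine tendsto_pi_nhds.2 fun i => tendsto_const_nhds.congr' ?_
  filter_upwards [eventually_gt_atTop i] with k hk
  rw [appendWord_apply_of_lt _ _ (by rwa [wordPrefix_length]), wordPrefix_getElem]

theorem appendWord_append (u v : List σ) (w : ℕ → σ) :
    appendWord (u ++ v) w = appendWord u (appendWord v w) := by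
  simp [appendWord]

end Words

/-! ### Stable families contract exponentially -/

namespace MatrixFamily

theorem wordProd_append {R : Type*} [Semiring R] (B : MatrixFamily R)
    (u v : List (Fin B.letters)) : B.wordProd (u ++ v) = B.wordProd u * B.wordProd v := by
  simp [wordProd]

theorem wordProd_singleton {R : Type*} [Semiring R] (B : MatrixFamily R)
    (a : Fin B.letters) : B.wordProd [a] = B.mat a := by
  simp [wordProd]

theorem wordProd_cons {R : Type*} [Semiring R] (B : MatrixFamily R)
    (a : Fin B.letters) (v : List (Fin B.letters)) :
    B.wordProd (a :: v) = B.mat a * B.wordProd v := by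
  simp [wordProd]

theorem wordProd_nil {R : Type*} [Semiring R] (B : MatrixFamily R) :
    B.wordProd [] = 1 := by
  simp [wordProd]

theorem continuous_wordProd_wordPrefix (B : MatrixFamily ℝ) (k : ℕ) :
    Continuous fun w : ℕ → Fin B.letters => B.wordProd (wordPrefix w k) := by
  induction k with
  | zero => exact continuous_const
  | succ k ih =>
    simp only [wordPrefix_succ, wordProd_append, wordProd_singleton]
    exact ih.matrix_mul (continuous_of_discreteTopology.comp (continuous_apply k))

/-- Compactness of the word space: the set of words with a small product of a given prefix is open,
because only finitely many letters matter, and stability says that these sets cover. The length `k +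
1` keeps the prefix nonempty, so that cutting it off shortens a word. -/
theorem IsStable.exists_uniform_prefix {B : MatrixFamily ℝ} (hB : B.IsStable) :
    ∃ N, ∀ w : ℕ → Fin B.letters, ∃ k < N, (B.wordProd (wordPrefix w (k + 1))).absSum < 1 / 2 := by
  let U : ℕ → Set (ℕ → Fin B.letters) := fun k =>
    {w | (B.wordProd (wordPrefix w (k + 1))).absSum < 1 / 2}
  have hU : ∀ k, IsOpen (U k) := fun k =>
    isOpen_lt (Matrix.continuous_absSum.comp (B.continuous_wordProd_wordPrefix (k + 1)))
      continuous_const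
  have hcov : (Set.univ : Set (ℕ → Fin B.letters)) ⊆ ⋃ k, U k := by
    intro w _
    have h : Tendsto (fun k => (B.wordProd (wordPrefix w (k + 1))).absSum) atTop (𝓝 0) := by
      have h1 := (Matrix.continuous_absSum.tendsto _).comp ((tendsto_add_atTop_iff_nat 1).2 (hB w))
      rwa [Matrix.absSum_zero] at h1
    obtain ⟨k, hk⟩ := (h.eventually (gt_mem_nhds (by norm_num : (0 : ℝ) < 1 / 2))).exists
    exact Set.mem_iUnion.2 ⟨k, hk⟩
  obtain ⟨t, ht⟩ := isCompact_univ.elim_finite_subcover U hU hcov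
  refine ⟨t.sup id + 1, fun w => ?_⟩
  obtain ⟨k, hk, hw⟩ := Set.mem_iUnion₂.1 (ht (Set.mem_univ w))
  exact ⟨k, Nat.lt_succ_of_le (Finset.le_sup (f := id) hk), hw⟩

/-- A stable family contracts long words exponentially. -/
theorem IsStable.exists_geometric_bound {B : MatrixFamily ℝ} (hB : B.IsStable) :
    ∃ C θ : ℝ, 0 ≤ C ∧ 0 ≤ θ ∧ θ < 1 ∧
      ∀ v : List (Fin B.letters), (B.wordProd v).absSum ≤ C * θ ^ v.length := by
  obtain ⟨N, hN⟩ := hB.exists_uniform_prefix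
  -- With `θ ^ N ≥ 1/2`, halving over a prefix of length at most `N` counts as a contraction by at
  -- least `θ` per letter.
  obtain ⟨θ, hθ0, hθ1, hθ⟩ : ∃ θ : ℝ, 0 < θ ∧ θ < 1 ∧ 1 / 2 ≤ θ ^ N := by
    have h1 : Tendsto (fun x : ℝ => x ^ N) (𝓝[<] 1) (𝓝 1) := by
      have := ((continuous_pow N).tendsto (1 : ℝ)).mono_left (nhdsWithin_le_nhds (s := Set.Iio 1))
      simpa using this
    have h2 := h1.eventually (lt_mem_nhds (by norm_num : (1 / 2 : ℝ) < 1))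
    have h3 : ∀ᶠ x : ℝ in 𝓝[<] 1, x ∈ Set.Ioo (0 : ℝ) 1 := Ioo_mem_nhdsLT one_pos
    obtain ⟨θ, h4, h5⟩ := (h2.and h3).exists
    exact ⟨θ, h5.1, h5.2, h4.le⟩
  obtain ⟨C, hC⟩ := ((List.finite_length_le (Fin B.letters) N).image
    fun v => (B.wordProd v).absSum).bddAbove
  have hC' : ∀ v : List (Fin B.letters), v.length ≤ N → (B.wordProd v).absSum ≤ C :=
    fun v hv => hC ⟨v, hv, rfl⟩
  have hC0 : 0 ≤ C := (Matrix.absSum_nonneg _).trans (hC' [] (Nat.zero_le _))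
  -- `C` bounds the words of length at most `N`; the factor `2` makes up for `θ ^ v.length`, which
  -- is still at least `1/2` there.
  refine ⟨2 * C, θ, by positivity, hθ0.le, hθ1, fun v => ?_⟩
  induction hl : v.length using Nat.strong_induction_on generalizing v with
  | _ l ih =>
  subst hl
  rcases le_or_gt v.length N with h | h
  · refine (hC' v h).trans ?_
    have : (1 / 2 : ℝ) ≤ θ ^ v.length := hθ.trans (pow_le_pow_of_le_one hθ0.le hθ1.le h)
    nlinarith
  · have hv : v ≠ [] := by
      rintro rfl
      simp at h
    -- The infinite tail is arbitrary, its letter being one that is surely available: the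
    -- contracting prefix has length at most `N` and so lies inside `v`.
    obtain ⟨k, hk, hw⟩ := hN (appendWord v fun _ => v.head hv)
    have hpre : wordPrefix (appendWord v fun _ => v.head hv) (k + 1) = v.take (k + 1) := by
      refine List.ext_getElem ?_ fun i h1 h2 => ?_
      · rw [wordPrefix_length, List.length_take]
        omega
      · rw [wordPrefix_getElem, List.getElem_take, appendWord_apply_of_lt]
    rw [hpre] at hw
    have hq := ih (v.drop (k + 1)).length (by rw [List.length_drop]; omega) _ rfl
    have hp : (B.wordProd (v.take (k + 1))).absSum ≤ θ ^ (k + 1) :=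
      hw.le.trans (hθ.trans (pow_le_pow_of_le_one hθ0.le hθ1.le hk))
    calc (B.wordProd v).absSum
        = (B.wordProd (v.take (k + 1)) * B.wordProd (v.drop (k + 1))).absSum := by
          rw [← wordProd_append, List.take_append_drop]
      _ ≤ θ ^ (k + 1) * (2 * C * θ ^ (v.drop (k + 1)).length) :=
          (Matrix.absSum_mul_le _ _).trans
            (mul_le_mul hp hq (Matrix.absSum_nonneg _) (by positivity))
      _ = 2 * C * θ ^ v.length := by
          have : v.length = (k + 1) + (v.drop (k + 1)).length := by
            rw [List.length_drop]
            omega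
          rw [this, pow_add]
          ring

/-- If the increments of the products are exponentially small, then the family is a continuous
RCP set. -/
theorem isContinuousRCP_of_geometric_bound {A : MatrixFamily ℝ} {C θ : ℝ} (hθ0 : 0 ≤ θ)
    (hθ : θ < 1) (h : ∀ (v : List (Fin A.letters)) (a : Fin A.letters),
      (A.wordProd v * (A.mat a - 1)).absSum ≤ C * θ ^ v.length) : A.IsContinuousRCP := by
  have hstep : ∀ (w : ℕ → Fin A.letters) i j k,
      dist (A.wordProd (wordPrefix w k) i j) (A.wordProd (wordPrefix w (k + 1)) i j)
        ≤ C * θ ^ k := by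
    intro w i j k
    have h1 := (Matrix.abs_apply_le_absSum _ i j).trans (h (wordPrefix w k) (w k))
    rw [wordPrefix_length] at h1
    rw [dist_comm, Real.dist_eq, wordPrefix_succ, wordProd_append, wordProd_singleton]
    rwa [mul_sub, mul_one, Matrix.sub_apply] at h1
  choose L hL using fun (w : ℕ → Fin A.letters) i j =>
    cauchySeq_tendsto_of_complete (cauchySeq_of_le_geometric θ C hθ (hstep w i j))
  refine ⟨L, fun w => Matrix.tendsto_iff_entries.2 (hL w), ?_⟩
  refine continuous_matrix fun i j => ?_
  -- The geometric tail estimate does not depend on `w`, so `L` is a uniform limit of functions that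
  -- depend on finitely many letters.
  have hunif : TendstoUniformly (fun k (w : ℕ → Fin A.letters) => A.wordProd (wordPrefix w k) i j)
      (fun w => L w i j) atTop := by
    rw [Metric.tendstoUniformly_iff]
    intro ε hε
    have h0 : Tendsto (fun k => C * θ ^ k / (1 - θ)) atTop (𝓝 0) := by
      simpa using ((tendsto_pow_atTop_nhds_zero_of_lt_one hθ0 hθ).const_mul C).div_const (1 - θ)
    filter_upwards [h0.eventually (gt_mem_nhds hε)] with k hk w
    rw [dist_comm]
    exact (dist_le_of_le_geometric_of_tendsto θ C hθ (hstep w i j) (hL w i j) k).trans_lt hk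
  exact hunif.continuous (Frequently.of_forall fun k =>
    (A.continuous_wordProd_wordPrefix k).matrix_elem i j)

/-- If the differences `A_a - 1` factor through the stable family of the `1 + X_a P`, then the
family of the `A_a = 1 + P X_a` is a continuous RCP set. -/
theorem isContinuousRCP_of_factor {k n m : ℕ} {A : Fin k → Matrix (Fin n) (Fin n) ℝ}
    {B : Fin k → Matrix (Fin m) (Fin m) ℝ} (P : Matrix (Fin n) (Fin m) ℝ)
    (X : Fin k → Matrix (Fin m) (Fin n) ℝ) (hA : ∀ a, A a - 1 = P * X a)
    (hB : ∀ a, A a * P = P * B a) (hst : (MatrixFamily.mk k m B).IsStable) :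
    (MatrixFamily.mk k n A).IsContinuousRCP := by
  obtain ⟨C, θ, hC, hθ0, hθ1, hbound⟩ := hst.exists_geometric_bound
  have hconj : ∀ v : List (Fin k), (MatrixFamily.mk k n A).wordProd v * P =
      P * (MatrixFamily.mk k m B).wordProd v := by
    intro v
    induction v with
    | nil => simp [wordProd]
    | cons a v ih =>
      rw [wordProd_cons, wordProd_cons, Matrix.mul_assoc, ih, ← Matrix.mul_assoc,
        ← Matrix.mul_assoc]
      exact congrArg (· * _) (hB a)
  obtain ⟨D, hD⟩ := (Set.finite_range fun a => (X a).absSum).bddAbove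
  have hD' : ∀ a, (X a).absSum ≤ max D 0 := fun a => (hD ⟨a, rfl⟩).trans (le_max_left _ _)
  refine isContinuousRCP_of_geometric_bound (C := P.absSum * C * max D 0) hθ0 hθ1
    fun v a => ?_
  change (_ * (A a - 1)).absSum ≤ _
  -- `A_v (A_a - 1) = A_v P X_a = P B_v X_a`, and the stable middle factor decays.
  rw [hA, ← Matrix.mul_assoc, hconj]
  calc (P * (MatrixFamily.mk k m B).wordProd v * X a).absSum
      ≤ P.absSum * (C * θ ^ v.length) * max D 0 := by
        refine (Matrix.absSum_mul_le _ _).trans (mul_le_mul ((Matrix.absSum_mul_le _ _).trans ?_)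
          (hD' a) (Matrix.absSum_nonneg _) ?_)
        · exact mul_le_mul_of_nonneg_left (hbound v) (Matrix.absSum_nonneg _)
        · exact mul_nonneg (Matrix.absSum_nonneg _) (by positivity)
    _ = P.absSum * C * max D 0 * θ ^ v.length := by ring

/-- The limits of a continuous RCP set absorb the matrices on the right. -/
theorem mul_mat_eq_of_hasLimit {A : MatrixFamily ℝ}
    {L : (ℕ → Fin A.letters) → Matrix (Fin A.dim) (Fin A.dim) ℝ}
    (hL : ∀ w, A.HasLimit w (L w)) (hc : Continuous L) (w : ℕ → Fin A.letters)
    (a : Fin A.letters) : L w * A.mat a = L w := by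
  have happ : ∀ v u, L (appendWord v u) = A.wordProd v * L u := by
    intro v u
    refine tendsto_nhds_unique ((hL _).comp (tendsto_add_atTop_nat v.length)) ?_
    have h : Tendsto (fun k => A.wordProd v * A.wordProd (wordPrefix u k)) atTop
        (𝓝 (A.wordProd v * L u)) := tendsto_const_nhds.mul (hL u)
    refine h.congr fun k => ?_
    rw [← wordProd_append, ← wordPrefix_appendWord, Function.comp, add_comm]
  have h1 : L (fun _ => a) * A.mat a = L (fun _ => a) := by
    have h : Tendsto (fun k => A.wordProd (wordPrefix (fun _ => a) k) * A.mat a) atTop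
        (𝓝 (L (fun _ => a) * A.mat a)) := (hL _).mul tendsto_const_nhds
    refine tendsto_nhds_unique h (((hL _).comp (tendsto_add_atTop_nat 1)).congr fun k => ?_)
    rw [← wordProd_singleton, ← wordProd_append, Function.comp, wordPrefix_succ]
  -- Continuity enters here: `A_{pref_k(w)} L(a^ω)` is the value of `L` at `pref_k(w) a^ω`, and
  -- these words tend to `w`.
  have h2 : L w * L (fun _ => a) = L w := by
    have h : Tendsto (fun k => A.wordProd (wordPrefix w k) * L (fun _ => a)) atTop
        (𝓝 (L w * L (fun _ => a))) := (hL w).mul tendsto_const_nhds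
    refine tendsto_nhds_unique h (((hc.tendsto w).comp
      (tendsto_appendWord_wordPrefix w fun _ _ => a)).congr fun k => ?_)
    rw [Function.comp, happ]
  rw [← h2, Matrix.mul_assoc, h1]

/-- If `A_a P = P B_a`, where `P` has a left inverse and its columns are combinations of columns
of the matrices `A_a - 1`, and the `A_a` form a continuous RCP set, then the `B_a` form a stable
family. -/
theorem IsContinuousRCP.isStable_of_conj {k n m : ℕ} {A : Fin k → Matrix (Fin n) (Fin n) ℝ}
    {B : Fin k → Matrix (Fin m) (Fin m) ℝ} (h : (MatrixFamily.mk k n A).IsContinuousRCP)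
    (P : Matrix (Fin n) (Fin m) ℝ) (R : Matrix (Fin m) (Fin n) ℝ)
    (hRP : R * P = 1) (hB : ∀ a, A a * P = P * B a)
    (hP : ∀ N : Matrix (Fin n) (Fin n) ℝ, (∀ a, N * A a = N) → N * P = 0) :
    (MatrixFamily.mk k m B).IsStable := by
  obtain ⟨L, hL, hc⟩ := h
  intro w
  have hconj : ∀ v : List (Fin k), R * ((MatrixFamily.mk k n A).wordProd v * P) =
      (MatrixFamily.mk k m B).wordProd v := by
    intro v
    have : (MatrixFamily.mk k n A).wordProd v * P = P * (MatrixFamily.mk k m B).wordProd v := by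
      induction v with
      | nil => simp [wordProd]
      | cons a v ih =>
        rw [wordProd_cons, wordProd_cons, Matrix.mul_assoc, ih, ← Matrix.mul_assoc,
          ← Matrix.mul_assoc]
        exact congrArg (· * _) (hB a)
    rw [this, ← Matrix.mul_assoc, hRP, Matrix.one_mul]
  have h0 : Tendsto (fun k' => R * ((MatrixFamily.mk k n A).wordProd (wordPrefix w k') * P)) atTop
      (𝓝 (R * (L w * P))) :=
    ((continuous_const.matrix_mul (continuous_id.matrix_mul continuous_const)).tendsto (L w)).comp
      (hL w)
  -- The limit absorbs all `A_a`, so it annihilates `P`; hence `B_v = R A_v P` tends to zero along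
  -- `w`.
  rw [hP (L w) fun a => mul_mat_eq_of_hasLimit hL hc w a, Matrix.mul_zero] at h0
  exact h0.congr fun k => hconj _

end MatrixFamily

/-! ### Average preserving automata -/

/-- A function on words that is the average of its values on the one-letter extensions does not
decrease along a suitable infinite word. -/
theorem exists_word_le_of_average {k : ℕ} (hk : 0 < k) {F : List (Fin k) → ℝ}
    (hF : ∀ v, ∑ a, F (v ++ [a]) = k * F v) (v : List (Fin k)) :
    ∃ w : ℕ → Fin k, ∀ j, F v ≤ F (v ++ wordPrefix w j) := by
  have : NeZero k := ⟨hk.ne'⟩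
  have hs : ∀ u, ∃ a, F u ≤ F (u ++ [a]) := by
    intro u
    by_contra! h
    have h1 : ∑ a, F (u ++ [a]) < ∑ _a : Fin k, F u :=
      Finset.sum_lt_sum_of_nonempty Finset.univ_nonempty fun a _ => h a
    simp [hF] at h1
  choose s hs using hs
  -- The greedy path: always append a letter whose value is at least the average.
  let p : ℕ → List (Fin k) := fun j => Nat.rec v (fun _ u => u ++ [s u]) j
  have hp : ∀ j, p j = v ++ wordPrefix (fun j => s (p j)) j := by
    intro j
    induction j with
    | zero => simp [p, wordPrefix]
    | succ j ih => rw [wordPrefix_succ, ← List.append_assoc, ← ih]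
  refine ⟨fun j => s (p j), fun j => ?_⟩
  rw [← hp]
  induction j with
  | zero => exact le_rfl
  | succ j ih => exact ih.trans (hs _)

namespace WFA

theorem wordFunction_append {R : Type*} [CommSemiring R] (A : WFA R)
    (u v : List (Fin A.letters)) : A.wordFunction (u ++ v) =
      Matrix.vecMul A.init (A.wordProd u) ⬝ᵥ (A.wordProd v).mulVec A.final := by
  rw [wordFunction, A.wordProd_append, ← Matrix.mulVec_mulVec, Matrix.dotProduct_mulVec]

theorem IsAveragePreserving.sum_wordFunction {R : Type*} [CommSemiring R] {A : WFA R}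
    (hA : A.IsAveragePreserving) (v : List (Fin A.letters)) :
    ∑ a, A.wordFunction (v ++ [a]) = A.letters * A.wordFunction v := by
  have h : A.wordFunction v = A.wordFunction (v ++ []) := by simp
  rw [h]
  simp only [wordFunction_append, A.wordProd_singleton, A.wordProd_nil, Matrix.one_mulVec]
  rw [← dotProduct_sum, hA, dotProduct_smul, nsmul_eq_mul]

/-- Bridges words and infinite words: where the limit exists, it yields a value of the `ω`-function
on a continuation of `v` that is at least `F_A(v)`. The companion `exists_ge` gives the opposite
bound. -/
theorem IsAveragePreserving.exists_le {A : WFA ℝ} (hA : A.IsAveragePreserving)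
    (hk : 0 < A.letters) (v : List (Fin A.letters)) :
    ∃ w : ℕ → Fin A.letters, ∀ j, A.wordFunction v ≤ A.wordFunction (v ++ wordPrefix w j) :=
  exists_word_le_of_average hk hA.sum_wordFunction v

theorem IsAveragePreserving.exists_ge {A : WFA ℝ} (hA : A.IsAveragePreserving)
    (hk : 0 < A.letters) (v : List (Fin A.letters)) :
    ∃ w : ℕ → Fin A.letters, ∀ j, A.wordFunction (v ++ wordPrefix w j) ≤ A.wordFunction v := by
  obtain ⟨w, hw⟩ := exists_word_le_of_average hk (F := fun v => - A.wordFunction v)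
    (fun v => by rw [Finset.sum_neg_distrib, hA.sum_wordFunction, mul_neg]) v
  exact ⟨w, fun j => neg_le_neg_iff.1 (hw j)⟩

theorem HasOmegaValue.tendsto_append {A : WFA ℝ} {v : List (Fin A.letters)}
    {w : ℕ → Fin A.letters} {y : ℝ} (h : A.HasOmegaValue (appendWord v w) y) :
    Tendsto (fun j => A.wordFunction (v ++ wordPrefix w j)) atTop (𝓝 y) := by
  refine (h.comp (tendsto_add_atTop_nat v.length)).congr fun j => ?_
  rw [Function.comp, add_comm, wordPrefix_appendWord]

/-- A squeeze: each term lies between two values of `f` at infinite continuations of `u pref_j(w)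
v`, and all such continuations tend to `uw`. The point is the fixed suffix `v`, about which
convergence of `F_A` along prefixes says nothing by itself. -/
theorem IsAveragePreserving.tendsto_of_continuous {A : WFA ℝ} (hA : A.IsAveragePreserving)
    (hk : 0 < A.letters) {f : (ℕ → Fin A.letters) → ℝ} (hf : ∀ w, A.HasOmegaValue w (f w))
    (hc : Continuous f) (u v : List (Fin A.letters)) (w : ℕ → Fin A.letters) :
    Tendsto (fun j => A.wordFunction (u ++ (wordPrefix w j ++ v))) atTop
      (𝓝 (f (appendWord u w))) := by
  choose lo hlo using hA.exists_ge hk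
  choose hi hhi using hA.exists_le hk
  -- Holds for any choice `g` of tails; it is used for the lower and the upper continuations.
  have hlim : ∀ g : List (Fin A.letters) → ℕ → Fin A.letters,
      Tendsto (fun j => f (appendWord (u ++ (wordPrefix w j ++ v)) (g (u ++ (wordPrefix w j ++ v)))))
        atTop (𝓝 (f (appendWord u w))) := by
    intro g
    simp only [appendWord_append]
    exact (hc.tendsto _).comp (((continuous_appendWord u).tendsto _).comp
      (tendsto_appendWord_wordPrefix w fun j => appendWord v (g (u ++ (wordPrefix w j ++ v)))))
  refine tendsto_of_tendsto_of_tendsto_of_le_of_le (hlim lo) (hlim hi) (fun j => ?_) fun j => ?_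
  · exact le_of_tendsto' (hf _).tendsto_append (hlo _)
  · exact ge_of_tendsto' (hf _).tendsto_append (hhi _)

theorem IsLeftMinimal.span_eq_top {K : Type*} [Field K] {A : WFA K} (hA : A.IsLeftMinimal) :
    Submodule.span K (Set.range fun u : List (Fin A.letters) =>
      Matrix.vecMul A.init (A.wordProd u)) = ⊤ :=
  Submodule.eq_top_of_finrank_eq (by rw [hA, Module.finrank_fin_fun])

theorem IsRightMinimal.span_eq_top {K : Type*} [Field K] {A : WFA K} (hA : A.IsRightMinimal) :
    Submodule.span K (Set.range fun u : List (Fin A.letters) =>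
      (A.wordProd u).mulVec A.final) = ⊤ :=
  Submodule.eq_top_of_finrank_eq (by rw [hA, Module.finrank_fin_fun])

/-- A condition that is linear in both arguments holds for all pairs of vectors if it holds for the
vectors reached by words. -/
theorem IsMinimal.induction {K : Type*} [Field K] {A : WFA K} (hA : A.IsMinimal)
    {p : (Fin A.dim → K) → (Fin A.dim → K) → Prop}
    (hword : ∀ u v, p (Matrix.vecMul A.init (A.wordProd u)) ((A.wordProd v).mulVec A.final))
    (hl0 : ∀ y, p 0 y) (hladd : ∀ x x' y, p x y → p x' y → p (x + x') y)
    (hlsmul : ∀ (c : K) x y, p x y → p (c • x) y)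
    (hr0 : ∀ x, p x 0) (hradd : ∀ x y y', p x y → p x y' → p x (y + y'))
    (hrsmul : ∀ (c : K) x y, p x y → p x (c • y)) (x y : Fin A.dim → K) : p x y := by
  have h1 : ∀ v, p x ((A.wordProd v).mulVec A.final) := by
    intro v
    have hx : x ∈ Submodule.span K (Set.range fun u : List (Fin A.letters) =>
      Matrix.vecMul A.init (A.wordProd u)) := by rw [hA.1.span_eq_top]; trivial
    induction hx using Submodule.span_induction with
    | mem x h =>
      obtain ⟨u, rfl⟩ := h
      exact hword u v
    | zero => exact hl0 _
    | add x x' _ _ h h' => exact hladd _ _ _ h h'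
    | smul c x _ h => exact hlsmul _ _ _ h
  have hy : y ∈ Submodule.span K (Set.range fun u : List (Fin A.letters) =>
      (A.wordProd u).mulVec A.final) := by rw [hA.2.span_eq_top]; trivial
  induction hy using Submodule.span_induction with
  | mem y h =>
    obtain ⟨v, rfl⟩ := h
    exact h1 v
  | zero => exact hr0 _
  | add y y' _ _ h h' => exact hradd _ _ _ h h'
  | smul c y _ h => exact hrsmul _ _ _ h

/-- The weight matrices of a minimal average preserving automaton with a continuous `ω`-function
form a continuous RCP set. -/
theorem IsMinimal.isContinuousRCP {A : WFA ℝ} (hmin : A.IsMinimal) (hA : A.IsAveragePreserving)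
    (hk : 0 < A.letters) (hc : A.OmegaContinuous) : A.toMatrixFamily.IsContinuousRCP := by
  obtain ⟨f, hf, hfc⟩ := hc
  have h : ∀ x y : Fin A.dim → ℝ, ∃ g : (ℕ → Fin A.letters) → ℝ, Continuous g ∧
      ∀ w, Tendsto (fun j => x ⬝ᵥ (A.wordProd (wordPrefix w j)).mulVec y) atTop (𝓝 (g w)) := by
    intro x y
    refine hmin.induction (p := fun x y => ∃ g : (ℕ → Fin A.letters) → ℝ, Continuous g ∧
      ∀ w, Tendsto (fun j => x ⬝ᵥ (A.wordProd (wordPrefix w j)).mulVec y) atTop (𝓝 (g w)))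
      (fun u v => ?_) (fun y => ?_) ?_ ?_ (fun x => ?_) ?_ ?_ x y
    -- For the row `I A_u` and the column `A_v F` the bilinear expression is `F_A(u pref_j(w) v)`.
    · refine ⟨fun w => f (appendWord u w), hfc.comp (continuous_appendWord u), fun w => ?_⟩
      refine (hA.tendsto_of_continuous hk hf hfc u v w).congr fun j => ?_
      rw [wordFunction_append, A.wordProd_append, Matrix.mulVec_mulVec]
    · exact ⟨fun _ => 0, continuous_const, fun w => by simp⟩
    · rintro x x' y ⟨g, hg, h⟩ ⟨g', hg', h'⟩
      exact ⟨fun w => g w + g' w, hg.add hg', fun w =>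
        ((h w).add (h' w)).congr fun j => (add_dotProduct _ _ _).symm⟩
    · rintro c x y ⟨g, hg, h⟩
      exact ⟨fun w => c * g w, continuous_const.mul hg, fun w =>
        ((h w).const_mul c).congr fun j => (smul_dotProduct _ _ _).symm⟩
    · exact ⟨fun _ => 0, continuous_const, fun w => by simp⟩
    · rintro x y y' ⟨g, hg, h⟩ ⟨g', hg', h'⟩
      exact ⟨fun w => g w + g' w, hg.add hg', fun w =>
        ((h w).add (h' w)).congr fun j => by rw [Matrix.mulVec_add, dotProduct_add]⟩
    · rintro c x y ⟨g, hg, h⟩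
      exact ⟨fun w => c * g w, continuous_const.mul hg, fun w =>
        ((h w).const_mul c).congr fun j => by
          rw [Matrix.mulVec_smul, dotProduct_smul, smul_eq_mul]⟩
  choose g hg hlim using fun i j => h (Pi.single i 1) (Pi.single j 1)
  refine ⟨fun w i j => g i j w, fun w => Matrix.tendsto_iff_entries.2 fun i j =>
    (hlim i j w).congr fun k => ?_, continuous_matrix fun i j => hg i j⟩
  simp

/-- The `ω`-function of an automaton is continuous if its weight matrices form a continuous RCP
set. -/
theorem omegaContinuous_of_isContinuousRCP {A : WFA ℝ}
    (h : A.toMatrixFamily.IsContinuousRCP) : A.OmegaContinuous := by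
  obtain ⟨L, hL, hc⟩ := h
  have hcont : Continuous fun X : Matrix (Fin A.dim) (Fin A.dim) ℝ =>
      A.init ⬝ᵥ X.mulVec A.final :=
    continuous_const.dotProduct (continuous_id.matrix_mulVec continuous_const)
  exact ⟨fun w => A.init ⬝ᵥ (L w).mulVec A.final, fun w => (hcont.tendsto _).comp (hL w),
    hcont.comp hc⟩

theorem omegaZero_of_dim_eq_zero {A : WFA ℝ} (h : A.dim = 0) : A.OmegaZero := by
  have : IsEmpty (Fin A.dim) := by rw [h]; infer_instance
  intro w
  refine tendsto_const_nhds.congr fun k => ?_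
  simp [wordFunction, dotProduct]

theorem OmegaZero.omegaContinuous {A : WFA ℝ} (h : A.OmegaZero) : A.OmegaContinuous :=
  ⟨fun _ => 0, h, continuous_const⟩

/-- A minimal average preserving automaton with vanishing `ω`-function has no states. -/
theorem IsMinimal.dim_eq_zero {A : WFA ℝ} (hmin : A.IsMinimal) (hA : A.IsAveragePreserving)
    (hk : 0 < A.letters) (h0 : A.OmegaZero) : A.dim = 0 := by
  -- Every `F_A(v)` lies between two values of the `ω`-function, both zero. By minimality all
  -- products of a row and a column then vanish, which a unit vector paired with itself refutes.
  have hF : ∀ v, A.wordFunction v = 0 := by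
    intro v
    obtain ⟨w, hw⟩ := hA.exists_le hk v
    obtain ⟨w', hw'⟩ := hA.exists_ge hk v
    exact le_antisymm (ge_of_tendsto' (h0 _).tendsto_append hw)
      (le_of_tendsto' (h0 _).tendsto_append hw')
  by_contra hd
  let i : Fin A.dim := ⟨0, Nat.pos_of_ne_zero hd⟩
  have := hmin.induction (p := fun x y => x ⬝ᵥ y = 0)
    (fun u v => by rw [← wordFunction_append, hF]) (by simp)
    (fun x x' y h h' => by rw [add_dotProduct, h, h', add_zero])
    (fun c x y h => by rw [smul_dotProduct, h, smul_zero]) (by simp)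
    (fun x y y' h h' => by rw [dotProduct_add, h, h', add_zero])
    (fun c x y h => by rw [dotProduct_smul, h, smul_zero]) (Pi.single i 1) (Pi.single i 1)
  simp at this

/-- In a right minimal automaton a common fixed row is determined by its product with the final
distribution. -/
theorem IsRightMinimal.eq_zero_of_fixed {K : Type*} [Field K] {A : WFA K}
    (hA : A.IsRightMinimal) {x : Fin A.dim → K} (hx : ∀ a, Matrix.vecMul x (A.mat a) = x)
    (hF : x ⬝ᵥ A.final = 0) : x = 0 := by
  -- A row fixed by all letters is fixed by all words, so its products with the `A_u F` all equal
  -- its product with `F`; these columns span.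
  have hu : ∀ u, Matrix.vecMul x (A.wordProd u) = x := by
    intro u
    induction u with
    | nil => simp [A.wordProd_nil]
    | cons a u ih => rw [A.wordProd_cons, ← Matrix.vecMul_vecMul, hx, ih]
  refine dotProduct_eq_zero x fun y => ?_
  have hy : y ∈ Submodule.span K (Set.range fun u : List (Fin A.letters) =>
      (A.wordProd u).mulVec A.final) := by rw [hA.span_eq_top]; trivial
  induction hy using Submodule.span_induction with
  | mem y h =>
    obtain ⟨v, rfl⟩ := h
    rw [Matrix.dotProduct_mulVec, hu, hF]
  | zero => simp
  | add y y' _ _ h h' => rw [dotProduct_add, h, h', add_zero]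
  | smul c y _ h => rw [dotProduct_smul, h, smul_zero]

/-- A minimal average preserving automaton with continuous `ω`-function has no states if the
matrices `A_a - 1` span the whole space. -/
theorem IsMinimal.omegaZero_of_sum_eq_one {A : WFA ℝ} (hmin : A.IsMinimal)
    (hA : A.IsAveragePreserving) (hk : 0 < A.letters) (hc : A.OmegaContinuous)
    (X : Fin A.letters → Matrix (Fin A.dim) (Fin A.dim) ℝ)
    (hX : ∑ a, (A.mat a - 1) * X a = 1) : A.OmegaZero := by
  obtain ⟨L, hL, hLc⟩ := hmin.isContinuousRCP hA hk hc
  have hL0 : ∀ w, L w = 0 := by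
    intro w
    -- Write the identity through the `A_a - 1`, each of which `L w` annihilates from the left.
    rw [← Matrix.mul_one (L w), ← hX, Finset.mul_sum]
    refine Finset.sum_eq_zero fun a _ => ?_
    rw [← Matrix.mul_assoc, Matrix.mul_sub, MatrixFamily.mul_mat_eq_of_hasLimit hL hLc w a,
      Matrix.mul_one, sub_self, Matrix.zero_mul]
  intro w
  have hcont : Continuous fun X : Matrix (Fin A.dim) (Fin A.dim) ℝ =>
      A.init ⬝ᵥ X.mulVec A.final :=
    continuous_const.dotProduct (continuous_id.matrix_mulVec continuous_const)
  have h := (hcont.tendsto _).comp (hL w)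
  rw [hL0, show A.init ⬝ᵥ (0 : Matrix (Fin A.dim) (Fin A.dim) ℝ).mulVec A.final = 0 by simp] at h
  exact h

/-- The continuity criterion for a minimal average preserving automaton whose matrices act by
the `B_a` on the column space of `P`, the kernel of a common fixed row. -/
theorem IsMinimal.omegaContinuous_iff_isStable {A : WFA ℝ} (hmin : A.IsMinimal)
    (hA : A.IsAveragePreserving) (hk : 0 < A.letters) {d : ℕ}
    {B : Fin A.letters → Matrix (Fin d) (Fin d) ℝ} (P : Matrix (Fin A.dim) (Fin d) ℝ)
    (R : Matrix (Fin d) (Fin A.dim) ℝ) (X : Fin A.letters → Matrix (Fin d) (Fin A.dim) ℝ)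
    (c : Fin A.dim → ℝ) (hRP : R * P = 1) (hX : ∀ a, A.mat a - 1 = P * X a)
    (hB : ∀ a, A.mat a * P = P * B a) (hc0 : c ≠ 0)
    (hc : ∀ a, Matrix.vecMul c (A.mat a) = c) (hcP : Matrix.vecMul c P = 0) :
    A.OmegaContinuous ↔ (MatrixFamily.mk A.letters d B).IsStable := by
  constructor
  · intro h
    refine MatrixFamily.IsContinuousRCP.isStable_of_conj (hmin.isContinuousRCP hA hk h) P R hRP hB
      fun N hN => ?_
    have hcF : c ⬝ᵥ A.final ≠ 0 := fun h => hc0 (hmin.2.eq_zero_of_fixed hc h)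
    ext i j
    -- Chosen so that the fixed row `N i - t • c` is orthogonal to the final vector and hence zero:
    -- every row of `N` is a multiple of `c`, which kills `P`.
    let t := (N i ⬝ᵥ A.final) / (c ⬝ᵥ A.final)
    have hi : N i - t • c = 0 := by
      refine hmin.2.eq_zero_of_fixed (fun a => ?_) ?_
      · have : Matrix.vecMul (N i) (A.mat a) = N i := by
          conv_rhs => rw [← hN a]
          rfl
        rw [Matrix.sub_vecMul, Matrix.smul_vecMul, hc, this]
      · rw [sub_dotProduct, smul_dotProduct, smul_eq_mul, div_mul_cancel₀ _ hcF, sub_self]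
    have h2 : (N * P) i = Matrix.vecMul (N i) P := rfl
    rw [h2, sub_eq_zero.1 hi, Matrix.smul_vecMul, hcP]
    simp
  · intro h
    exact omegaContinuous_of_isContinuousRCP
      (MatrixFamily.isContinuousRCP_of_factor P X hX hB h)

end WFA

/-! ### Reachability certificates -/

section Reach

variable {K : Type*} [Field K] {n : ℕ}

/-- Each row listed in `U` is `x` or arises from an earlier row by one of the `k` matrices `M a`,
and the rows have the left inverse listed in `Z`. -/
def IsReachCertificate (k : ℕ) (M : ℕ → Matrix (Fin n) (Fin n) K) (x : Matrix (Fin 1) (Fin n) K)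
    (c : List (List K) × List (List K)) : Prop :=
  (∀ i < c.1.length, Matrix.ofLists 1 n [c.1.getD i []] = x ∨ ∃ j < i, ∃ a < k,
    Matrix.ofLists 1 n [c.1.getD i []] = Matrix.ofLists 1 n [c.1.getD j []] * M a) ∧
  Matrix.ofLists n c.1.length c.2 * Matrix.ofLists c.1.length n c.1 = 1

/-- The rows reached from the row `x` by the first `k` of the matrices `M a`. -/
inductive Reached (k : ℕ) (M : ℕ → Matrix (Fin n) (Fin n) K) (x : Fin n → K) :
    (Fin n → K) → Prop
  | base : Reached k M x x
  | step {y : Fin n → K} {a : ℕ} : Reached k M x y → a < k →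
      Reached k M x (Matrix.vecMul y (M a))

/-- Each row in the list is `x` or arises from an earlier one. -/
def IsDerivation (k : ℕ) (M : ℕ → Matrix (Fin n) (Fin n) K) (x : Fin n → K)
    (l : List (Fin n → K)) : Prop :=
  ∀ i < l.length, l.getD i 0 = x ∨ ∃ j < i, ∃ a < k, l.getD i 0 = Matrix.vecMul (l.getD j 0) (M a)

variable {k : ℕ} {M : ℕ → Matrix (Fin n) (Fin n) K} {x : Fin n → K}

theorem isDerivation_nil : IsDerivation k M x [] :=
  fun i hi => absurd hi (Nat.not_lt_zero i)

theorem IsDerivation.append {l l' : List (Fin n → K)} (h : IsDerivation k M x l)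
    (h' : IsDerivation k M x l') : IsDerivation k M x (l ++ l') := by
  intro i hi
  rcases lt_or_ge i l.length with hl | hl
  · rcases h i hl with h1 | ⟨j, hj, a, ha, h1⟩
    · exact Or.inl (by rwa [List.getD_append _ _ _ _ hl])
    · exact Or.inr ⟨j, hj, a, ha, by
        rwa [List.getD_append _ _ _ _ hl, List.getD_append _ _ _ _ (hj.trans hl)]⟩
  · have hi' : i - l.length < l'.length := by
      rw [List.length_append] at hi
      omega
    rcases h' _ hi' with h1 | ⟨j, hj, a, ha, h1⟩
    · exact Or.inl (by rwa [List.getD_append_right _ _ _ _ hl])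
    · refine Or.inr ⟨l.length + j, by omega, a, ha, ?_⟩
      rwa [List.getD_append_right _ _ _ _ hl, List.getD_append_right _ _ _ _ (by omega),
        Nat.add_sub_cancel_left]

theorem IsDerivation.concat {l : List (Fin n → K)} (h : IsDerivation k M x l) {y : Fin n → K}
    (hy : y = x ∨ ∃ z ∈ l, ∃ a < k, y = Matrix.vecMul z (M a)) :
    IsDerivation k M x (l ++ [y]) := by
  intro i hi
  rcases lt_or_ge i l.length with hl | hl
  · rcases h i hl with h1 | ⟨j, hj, a, ha, h1⟩
    · exact Or.inl (by rwa [List.getD_append _ _ _ _ hl])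
    · exact Or.inr ⟨j, hj, a, ha, by
        rwa [List.getD_append _ _ _ _ hl, List.getD_append _ _ _ _ (hj.trans hl)]⟩
  · have hi' : i = l.length := by
      rw [List.length_append, List.length_singleton] at hi
      omega
    subst hi'
    have hget : (l ++ [y]).getD l.length 0 = y := by simp
    rw [hget]
    rcases hy with h1 | ⟨z, hz, a, ha, h1⟩
    · exact Or.inl h1
    · obtain ⟨j, hj, rfl⟩ := List.getElem_of_mem hz
      exact Or.inr ⟨j, hj, a, ha, by
        rw [List.getD_append _ _ _ _ hj, List.getD_eq_getElem _ _ hj, h1]⟩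

theorem Reached.exists_derivation {y : Fin n → K} (h : Reached k M x y) :
    ∃ l, IsDerivation k M x l ∧ y ∈ l := by
  induction h with
  | base =>
    refine ⟨[] ++ [x], isDerivation_nil.concat (Or.inl rfl), by simp⟩
  | @step y a _ ha ih =>
    obtain ⟨l, hl, hy⟩ := ih
    exact ⟨l ++ [Matrix.vecMul y (M a)], hl.concat (Or.inr ⟨y, hy, a, ha, rfl⟩), by simp⟩

/-- A linear combination involves only finitely many reached rows, and derivations may be
concatenated. -/
theorem exists_derivation_of_mem_span {y : Fin n → K}
    (hy : y ∈ Submodule.span K {y | Reached k M x y}) :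
    ∃ l, IsDerivation k M x l ∧ y ∈ Submodule.span K {z | z ∈ l} := by
  induction hy using Submodule.span_induction with
  | mem y h =>
    obtain ⟨l, hl, hy⟩ := h.exists_derivation
    exact ⟨l, hl, Submodule.subset_span hy⟩
  | zero => exact ⟨[], isDerivation_nil, Submodule.zero_mem _⟩
  | add y y' _ _ h h' =>
    obtain ⟨l, hl, hy⟩ := h
    obtain ⟨l', hl', hy'⟩ := h'
    exact ⟨l ++ l', hl.append hl', Submodule.add_mem _
      (Submodule.span_mono (fun z hz => List.mem_append_left _ hz) hy)
      (Submodule.span_mono (fun z hz => List.mem_append_right _ hz) hy')⟩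
  | smul c y _ h =>
    obtain ⟨l, hl, hy⟩ := h
    exact ⟨l, hl, Submodule.smul_mem _ _ hy⟩

theorem exists_derivation_of_span_eq_top (h : Submodule.span K {y | Reached k M x y} = ⊤)
    (ys : List (Fin n → K)) :
    ∃ l, IsDerivation k M x l ∧ ∀ y ∈ ys, y ∈ Submodule.span K {z | z ∈ l} := by
  induction ys with
  | nil => exact ⟨[], isDerivation_nil, by simp⟩
  | cons y ys ih =>
    obtain ⟨l, hl, hy⟩ := ih
    obtain ⟨l', hl', hy'⟩ := exists_derivation_of_mem_span (y := y) (h ▸ Submodule.mem_top)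
    refine ⟨l' ++ l, hl'.append hl, fun z hz => ?_⟩
    rcases List.mem_cons.1 hz with rfl | hz
    · exact Submodule.span_mono (fun z hz => List.mem_append_left _ hz) hy'
    · exact Submodule.span_mono (fun z hz => List.mem_append_right _ hz) (hy z hz)

/-- Completeness of certificates: if the reached rows span, one finite derivation already spans all
unit vectors, and the coefficients that express these are the left inverse. -/
theorem exists_isReachCertificate (h : Submodule.span K {y | Reached k M x y} = ⊤) :
    ∃ c, IsReachCertificate k M (Matrix.of fun _ j => x j) c := by
  obtain ⟨l, hl, hspan⟩ := exists_derivation_of_span_eq_top h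
    (List.ofFn fun i : Fin n => (Pi.single i 1 : Fin n → K))
  have hZ : ∀ i : Fin n, ∃ z : Fin l.length → K, ∑ j, z j • l.get j = Pi.single i 1 := by
    intro i
    have := hspan (Pi.single i 1) ((List.mem_ofFn' _ _).2 ⟨i, rfl⟩)
    rwa [← Set.range_list_get, Submodule.mem_span_range_iff_exists_fun] at this
  choose z hz using hZ
  have hU : ∀ i, i < l.length →
      Matrix.ofLists 1 n [(l.map List.ofFn).getD i []] = Matrix.of fun _ j => l.getD i 0 j := by
    intro i hi
    ext a j
    simp [Matrix.ofLists, hi]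
  obtain ⟨Z, hZ⟩ := Matrix.exists_ofLists (n := n) (m := (l.map List.ofFn).length)
    (Matrix.of fun i j => z i (Fin.cast (by simp) j))
  refine ⟨(l.map List.ofFn, Z), fun i hi => ?_, ?_⟩
  · simp only [List.length_map] at hi
    rw [hU i hi]
    rcases hl i hi with h1 | ⟨j, hj, a, ha, h1⟩
    · exact Or.inl (by rw [h1])
    · refine Or.inr ⟨j, hj, a, ha, ?_⟩
      rw [hU j (hj.trans hi), h1]
      rfl
  · change Matrix.ofLists n (l.map List.ofFn).length Z *
      Matrix.ofLists (l.map List.ofFn).length n (l.map List.ofFn) = 1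
    rw [hZ]
    ext i j
    have h1 := congrFun (hz i) j
    rw [Matrix.mul_apply, Matrix.one_apply, Fintype.sum_equiv (finCongr (List.length_map _)) _
      (fun t => z i t * l.get t j)]
    · simpa [Finset.sum_apply, Pi.single_apply, eq_comm] using h1
    · intro t
      have ht : (t : ℕ) < l.length := by simpa using t.2
      simp [Matrix.ofLists, ht]

/-- Soundness of certificates: listed rows are reached by strong induction on their position, and a
left inverse `Z` writes any `y` as the combination of them with coefficients `y Z`. -/
theorem IsReachCertificate.span_eq_top {c : List (List K) × List (List K)}
    (h : IsReachCertificate k M (Matrix.of fun _ j => x j) c) :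
    Submodule.span K {y | Reached k M x y} = ⊤ := by
  have hrow : ∀ i, i < c.1.length → Reached k M x (Matrix.ofLists 1 n [c.1.getD i []] 0) := by
    intro i
    induction i using Nat.strong_induction_on with
    | _ i ih =>
    intro hi
    rcases h.1 i hi with h1 | ⟨j, hj, a, ha, h1⟩
    · rw [h1]
      exact Reached.base
    · rw [h1]
      exact (ih j hj (hj.trans hi)).step ha
  refine eq_top_iff.2 fun y _ => ?_
  rw [← Matrix.vecMul_one y, ← h.2, ← Matrix.vecMul_vecMul, Matrix.vecMul_eq_sum]
  refine Submodule.sum_mem _ fun i _ => Submodule.smul_mem _ _ (Submodule.subset_span ?_)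
  exact hrow i i.2

end Reach

/-- A certificate involves only bounded quantifiers over matrix identities, so it can be tested;
this is what makes minimality accessible to search. -/
theorem ComputablePred.isReachCertificate {α K : Type*} [Primcodable α] [Field K] [Primcodable K]
    (hadd : Computable₂ fun x y : K => x + y) (hmul : Computable₂ fun x y : K => x * y)
    {n k : α → ℕ} {M : ∀ a, ℕ → Matrix (Fin (n a)) (Fin (n a)) K}
    {x : ∀ a, Matrix (Fin 1) (Fin (n a)) K} {c : α → List (List K) × List (List K)}
    (hn : Computable n) (hk : Computable k)
    (hM : ComputableMatrix (n := fun x => n x.1) (m := fun x => n x.1) fun x : α × ℕ => M x.1 x.2)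
    (hx : ComputableMatrix (n := fun _ => 1) x) (hc : Computable c) :
    ComputablePred fun a => IsReachCertificate (k a) (M a) (x a) (c a) := by
  have hlen : Computable fun a => (c a).1.length :=
    Computable.list_length.comp (Computable.fst.comp hc)
  have hrow : ∀ {β : Type _} [Primcodable β] {f : β → α} {i : β → ℕ}, Computable f →
      Computable i → ComputableMatrix (n := fun _ => 1) (m := fun b => n (f b))
        fun b => Matrix.ofLists 1 (n (f b)) [(c (f b)).1.getD (i b) []] :=
    fun hf hi => ComputableMatrix.ofLists (Computable.list_cons.comp
      (Computable.list_getD _ (Computable.fst.comp (hc.comp hf)) hi) (Computable.const []))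
  refine (ComputablePred.ball_lt hlen (.or ?_ (.bex_lt Computable.snd
    (.bex_lt (hk.comp (Computable.fst.comp Computable.fst)) ?_)))).and ?_
  · exact ComputableMatrix.eq (Computable.const 1) (hn.comp Computable.fst)
      (hrow Computable.fst Computable.snd) (hx.comp Computable.fst)
  · have hf : Computable fun y : ((α × ℕ) × ℕ) × ℕ => y.1.1.1 :=
      Computable.fst.comp (Computable.fst.comp Computable.fst)
    exact ComputableMatrix.eq (Computable.const 1) (hn.comp hf)
      (hrow hf (Computable.snd.comp (Computable.fst.comp Computable.fst)))
      (ComputableMatrix.mul hadd hmul (hn.comp hf)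
        (hrow hf (Computable.snd.comp Computable.fst)) (hM.comp (hf.pair Computable.snd)))
  · exact ComputableMatrix.eq hn hn (ComputableMatrix.mul hadd hmul hlen
      (ComputableMatrix.ofLists (Computable.snd.comp hc))
      (ComputableMatrix.ofLists (Computable.fst.comp hc))) ComputableMatrix.one

/-! ### Existence of minimal automata -/

/-- The columns of `P` are a basis of `S`, and `R` extends the coordinate map of `S` to the whole
space. -/
theorem Submodule.exists_matrix_retraction {K : Type*} [Field K] {n : ℕ}
    (S : Submodule K (Fin n → K)) :
    ∃ (d : ℕ) (P : Matrix (Fin n) (Fin d) K) (R : Matrix (Fin d) (Fin n) K), R * P = 1 ∧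
      (∀ x ∈ S, P.mulVec (R.mulVec x) = x) ∧ ∀ y, P.mulVec y ∈ S := by
  let e : S ≃ₗ[K] (Fin (Module.finrank K S) → K) := (Module.finBasis K S).equivFun
  let p : (Fin (Module.finrank K S) → K) →ₗ[K] (Fin n → K) := S.subtype ∘ₗ e.symm.toLinearMap
  have hp : LinearMap.ker p = ⊥ :=
    LinearMap.ker_eq_bot.2 (S.injective_subtype.comp e.symm.injective)
  obtain ⟨r, hr⟩ := p.exists_leftInverse_of_injective hp
  refine ⟨Module.finrank K S, LinearMap.toMatrix' p, LinearMap.toMatrix' r, ?_, fun x hx => ?_,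
    fun y => ?_⟩
  · rw [← LinearMap.toMatrix'_comp, hr, LinearMap.toMatrix'_id]
  · rw [LinearMap.toMatrix'_mulVec, LinearMap.toMatrix'_mulVec]
    have hx' : x = p (e ⟨x, hx⟩) := by simp [p]
    have := LinearMap.congr_fun hr (e ⟨x, hx⟩)
    rw [LinearMap.comp_apply, ← hx'] at this
    rw [this, LinearMap.id_apply, ← hx']
  · rw [LinearMap.toMatrix'_mulVec]
    exact (e.symm y).2

namespace WFA

/-- The reversed automaton. -/
def transpose {R : Type*} (A : WFA R) : WFA R where
  letters := A.letters
  dim := A.dim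
  mat a := (A.mat a).transpose
  init := A.final
  final := A.init

section Field

variable {K : Type*} [Field K]

theorem transpose_wordProd (A : WFA K) (u : List (Fin A.letters)) :
    A.transpose.wordProd u = (A.wordProd u.reverse).transpose := by
  induction u with
  | nil => exact Matrix.transpose_one.symm
  | cons a u ih =>
    rw [List.reverse_cons, A.wordProd_append, A.wordProd_singleton, Matrix.transpose_mul, ← ih]
    exact A.transpose.wordProd_cons a u

theorem transpose_matAt (A : WFA K) (a : ℕ) :
    A.transpose.matAt a = (A.matAt a).transpose := by
  unfold MatrixFamily.matAt
  by_cases h : a < A.letters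
  · rw [dif_pos h, dif_pos (show a < A.transpose.letters from h)]
    rfl
  · rw [dif_neg h, dif_neg (show ¬ a < A.transpose.letters from h)]
    rfl

theorem isLeftMinimal_iff {A : WFA K} : A.IsLeftMinimal ↔
    Submodule.span K (Set.range fun u : List (Fin A.letters) =>
      Matrix.vecMul A.init (A.wordProd u)) = ⊤ :=
  ⟨IsLeftMinimal.span_eq_top, fun h => by rw [IsLeftMinimal, h, finrank_top, Module.finrank_fin_fun]⟩

theorem isRightMinimal_iff {A : WFA K} : A.IsRightMinimal ↔
    Submodule.span K (Set.range fun u : List (Fin A.letters) =>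
      (A.wordProd u).mulVec A.final) = ⊤ :=
  ⟨IsRightMinimal.span_eq_top,
    fun h => by rw [IsRightMinimal, h, finrank_top, Module.finrank_fin_fun]⟩

theorem isLeftMinimal_transpose_iff {A : WFA K} :
    A.transpose.IsLeftMinimal ↔ A.IsRightMinimal := by
  rw [isLeftMinimal_iff, isRightMinimal_iff]
  have hvec : ∀ u : List (Fin A.letters), Matrix.vecMul A.final (A.transpose.wordProd u) =
      (A.wordProd u.reverse).mulVec A.final := fun u =>
    (congrArg (Matrix.vecMul A.final) (A.transpose_wordProd u)).trans (Matrix.vecMul_transpose _ _)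
  have h : (Set.range fun u : List (Fin A.transpose.letters) =>
      Matrix.vecMul A.transpose.init (A.transpose.wordProd u)) =
      Set.range fun u : List (Fin A.letters) => (A.wordProd u).mulVec A.final := by
    refine Set.Subset.antisymm ?_ ?_
    · rintro _ ⟨u, rfl⟩
      refine ⟨u.reverse, ?_⟩
      exact (hvec u).symm
    · rintro _ ⟨u, rfl⟩
      refine ⟨u.reverse, ?_⟩
      have h := hvec u.reverse
      rw [List.reverse_reverse] at h
      exact h
  exact Iff.of_eq (congrArg (fun s => Submodule.span K s = ⊤) h)

theorem reached_iff (A : WFA K) (y : Fin A.dim → K) :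
    Reached A.letters A.matAt A.init y ↔ ∃ u, Matrix.vecMul A.init (A.wordProd u) = y := by
  constructor
  · intro h
    induction h with
    | base => exact ⟨[], by rw [A.wordProd_nil, Matrix.vecMul_one]⟩
    | @step y a _ ha ih =>
      obtain ⟨u, hu⟩ := ih
      refine ⟨u ++ [⟨a, ha⟩], ?_⟩
      rw [A.wordProd_append, A.wordProd_singleton, ← Matrix.vecMul_vecMul, hu, ← A.matAt_coe]
  · rintro ⟨u, rfl⟩
    induction u using List.reverseRecOn with
    | nil =>
      rw [A.wordProd_nil, Matrix.vecMul_one]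
      exact Reached.base
    | append_singleton u a ih =>
      rw [A.wordProd_append, A.wordProd_singleton, ← Matrix.vecMul_vecMul, ← A.matAt_coe]
      exact ih.step a.2

theorem isLeftMinimal_iff_exists_certificate {A : WFA K} :
    A.IsLeftMinimal ↔ ∃ c, IsReachCertificate A.letters A.matAt A.initRow c := by
  have h : {y | Reached A.letters A.matAt A.init y} =
      Set.range fun u : List (Fin A.letters) => Matrix.vecMul A.init (A.wordProd u) := by
    ext y
    exact A.reached_iff y
  rw [isLeftMinimal_iff, ← h]
  exact ⟨fun h => exists_isReachCertificate h, fun ⟨_, hc⟩ => hc.span_eq_top⟩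

theorem isRightMinimal_iff_exists_certificate {A : WFA K} :
    A.IsRightMinimal ↔ ∃ c, IsReachCertificate A.letters (fun a => (A.matAt a).transpose)
      A.finalCol.transpose c := by
  rw [← isLeftMinimal_transpose_iff, isLeftMinimal_iff_exists_certificate,
    show A.transpose.matAt = fun a => (A.matAt a).transpose from funext A.transpose_matAt]
  rfl

/-- The matrix `G` intertwines two automata over the same alphabet. -/
def Intertwines (A B : WFA K) (G : Matrix (Fin A.dim) (Fin B.dim) K) : Prop :=
  A.letters = B.letters ∧ B.initRow = A.initRow * G ∧ A.finalCol = G * B.finalCol ∧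
    ∀ a < A.letters, A.matAt a * G = G * B.matAt a

/-- `G` moves through the product from left to right: `I' N_v F' = I G N_v F' = I M_v G F' = I M_v
F`. -/
theorem Intertwines.sameWordFunction {A B : WFA K} {G : Matrix (Fin A.dim) (Fin B.dim) K}
    (h : A.Intertwines B G) : A.SameWordFunction B := by
  obtain ⟨⟨k, n, M⟩, I, F⟩ := A
  obtain ⟨⟨k', m, N⟩, I', F'⟩ := B
  obtain ⟨hl, hI, hF, hM⟩ := h
  dsimp only at hl hM G
  subst hl
  refine ⟨rfl, fun v => ?_⟩
  have hI' : I' = Matrix.vecMul I G := congrFun hI 0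
  have hF' : F = G.mulVec F' := funext fun i => congrFun (congrFun hF i) 0
  have hM' : ∀ a, M a * G = G * N a := fun a => by
    simpa [MatrixFamily.matAt] using hM a a.2
  have hv : (MatrixFamily.mk k n M).wordProd v * G = G * (MatrixFamily.mk k m N).wordProd v := by
    induction v with
    | nil => simp [MatrixFamily.wordProd]
    | cons a v ih =>
      rw [MatrixFamily.wordProd_cons, MatrixFamily.wordProd_cons, Matrix.mul_assoc, ih,
        ← Matrix.mul_assoc, ← Matrix.mul_assoc]
      exact congrArg (· * _) (hM' a)
  have hcast : v.map (Fin.cast rfl) = v := by simp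
  rw [hcast]
  change I' ⬝ᵥ ((MatrixFamily.mk k m N).wordProd v).mulVec F' =
    I ⬝ᵥ ((MatrixFamily.mk k n M).wordProd v).mulVec F
  rw [hI', hF', Matrix.mulVec_mulVec, hv, ← Matrix.mulVec_mulVec, Matrix.dotProduct_mulVec,
    Matrix.dotProduct_mulVec, Matrix.dotProduct_mulVec, Matrix.vecMul_vecMul]

theorem SameWordFunction.symm {A B : WFA K} (h : A.SameWordFunction B) : B.SameWordFunction A := by
  obtain ⟨⟨k, n, M⟩, I, F⟩ := A
  obtain ⟨⟨k', m, N⟩, I', F'⟩ := B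
  obtain ⟨hl, h⟩ := h
  dsimp only at hl
  subst hl
  refine ⟨rfl, fun v => ?_⟩
  have := h v
  simpa using this.symm

theorem SameWordFunction.trans {A B C : WFA K} (h : A.SameWordFunction B)
    (h' : B.SameWordFunction C) : A.SameWordFunction C := by
  obtain ⟨hl, h⟩ := h
  obtain ⟨hl', h'⟩ := h'
  refine ⟨hl.trans hl', fun v => ?_⟩
  rw [← h v, ← h' (v.map (Fin.cast hl)), List.map_map]
  rfl

/-- Right multiplication by `G` carries the left reachable space of `A` onto that of `B`, and it is
surjective on rows because `y = (y R) G`. -/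
theorem Intertwines.isLeftMinimal {A B : WFA K} {G : Matrix (Fin A.dim) (Fin B.dim) K}
    (h : A.Intertwines B G) (hA : A.IsLeftMinimal) {R : Matrix (Fin B.dim) (Fin A.dim) K}
    (hR : R * G = 1) : B.IsLeftMinimal := by
  obtain ⟨⟨k, n, M⟩, I, F⟩ := A
  obtain ⟨⟨k', m, N⟩, I', F'⟩ := B
  obtain ⟨hl, hI, hF, hM⟩ := h
  dsimp only at hl hM G R
  subst hl
  have hI' : I' = Matrix.vecMul I G := congrFun hI 0
  have hM' : ∀ a, M a * G = G * N a := fun a => by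
    simpa [MatrixFamily.matAt] using hM a a.2
  rw [isLeftMinimal_iff] at hA ⊢
  have hv : ∀ v, (MatrixFamily.mk k n M).wordProd v * G =
      G * (MatrixFamily.mk k m N).wordProd v := by
    intro v
    induction v with
    | nil => simp [MatrixFamily.wordProd]
    | cons a v ih =>
      rw [MatrixFamily.wordProd_cons, MatrixFamily.wordProd_cons, Matrix.mul_assoc, ih,
        ← Matrix.mul_assoc, ← Matrix.mul_assoc]
      exact congrArg (· * _) (hM' a)
  have himg : Submodule.map (Matrix.vecMulLinear G) (Submodule.span K (Set.range fun u =>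
      Matrix.vecMul I ((MatrixFamily.mk k n M).wordProd u))) =
      Submodule.span K (Set.range fun u =>
        Matrix.vecMul I' ((MatrixFamily.mk k m N).wordProd u)) := by
    rw [Submodule.map_span, ← Set.range_comp]
    congr 2
    funext u
    rw [hI']
    simp [Matrix.vecMul_vecMul, hv]
  refine Eq.trans himg.symm (eq_top_iff.2 fun y _ => ?_)
  refine ⟨Matrix.vecMul y R, ?_, ?_⟩
  · exact hA ▸ Submodule.mem_top
  · simp [Matrix.vecMul_vecMul, hR]

/-- Every automaton is intertwined with a right minimal one, without loss of left minimality. -/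
theorem exists_isRightMinimal (A : WFA K) : ∃ (B : WFA K) (G : Matrix (Fin A.dim) (Fin B.dim) K),
    A.Intertwines B G ∧ B.IsRightMinimal ∧ (A.IsLeftMinimal → B.IsLeftMinimal) := by
  let S : Submodule K (Fin A.dim → K) := Submodule.span K
    (Set.range fun u : List (Fin A.letters) => (A.wordProd u).mulVec A.final)
  obtain ⟨d, P, R, hRP, hPR, hP⟩ := S.exists_matrix_retraction
  have hF : A.final ∈ S := Submodule.subset_span ⟨[], by simp [A.wordProd_nil]⟩
  have hinv : ∀ a, ∀ x ∈ S, (A.mat a).mulVec x ∈ S := by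
    intro a x hx
    induction hx using Submodule.span_induction with
    | mem x h =>
      obtain ⟨u, rfl⟩ := h
      refine Submodule.subset_span ⟨a :: u, ?_⟩
      simp only [A.wordProd_cons, Matrix.mulVec_mulVec]
    | zero => simp
    | add x y _ _ h h' => rw [Matrix.mulVec_add]; exact S.add_mem h h'
    | smul c x _ h => rw [Matrix.mulVec_smul]; exact S.smul_mem c h
  have hM : ∀ a, A.mat a * P = P * (R * A.mat a * P) := by
    intro a
    refine Matrix.ext_of_mulVec_single fun i => ?_
    rw [← Matrix.mulVec_mulVec, ← Matrix.mulVec_mulVec, ← Matrix.mulVec_mulVec,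
      ← Matrix.mulVec_mulVec, hPR _ (hinv a _ (hP _))]
  -- The restriction of `A` to the invariant subspace `S`, in the coordinates given by `P` and `R`.
  let B : WFA K :=
    { letters := A.letters
      dim := d
      mat := fun a => R * A.mat a * P
      init := Matrix.vecMul A.init P
      final := R.mulVec A.final }
  have hBF : P.mulVec B.final = A.final := hPR _ hF
  have hint : A.Intertwines B P := by
    refine ⟨rfl, rfl, ?_, fun a ha => ?_⟩
    · ext i j
      exact (congrFun hBF i).symm
    · have h1 := A.matAt_coe ⟨a, ha⟩
      have h2 := B.matAt_coe ⟨a, ha⟩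
      simp only at h1 h2
      rw [h1, h2]
      exact hM _
  refine ⟨B, P, hint, ?_, fun h => hint.isLeftMinimal h (R := R) hRP⟩
  rw [isRightMinimal_iff, eq_top_iff]
  have hconj : ∀ u, P.mulVec ((B.wordProd u).mulVec B.final) = (A.wordProd u).mulVec A.final := by
    intro u
    induction u with
    | nil => rw [B.wordProd_nil, A.wordProd_nil, Matrix.one_mulVec, Matrix.one_mulVec, hBF]
    | cons a u ih =>
      have h1 : P.mulVec ((B.mat a).mulVec ((B.wordProd u).mulVec B.final)) =
          (A.mat a).mulVec ((A.wordProd u).mulVec A.final) := by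
        refine Eq.trans ?_ (congrArg (A.mat a).mulVec ih)
        rw [Matrix.mulVec_mulVec _ P, Matrix.mulVec_mulVec _ (A.mat a) P]
        exact congrArg (fun X : Matrix (Fin A.dim) (Fin d) K =>
          X.mulVec ((B.wordProd u).mulVec B.final)) (hM a).symm
      rw [B.wordProd_cons, ← Matrix.mulVec_mulVec, h1, Matrix.mulVec_mulVec]
      exact congrArg (fun X : Matrix (Fin A.dim) (Fin A.dim) K => X.mulVec A.final)
        (A.wordProd_cons a u).symm
  -- `R` sends the generators `A_u F` of `S` to the corresponding vectors of `B`, and it maps `S`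
  -- onto the whole coordinate space.
  have key : ∀ x ∈ S, R.mulVec x ∈ Submodule.span K (Set.range fun u : List (Fin B.letters) =>
      (B.wordProd u).mulVec B.final) := by
    intro x hx
    induction hx using Submodule.span_induction with
    | mem x h =>
      obtain ⟨u, rfl⟩ := h
      refine Submodule.subset_span ⟨u, ?_⟩
      simp only [← hconj]
      rw [Matrix.mulVec_mulVec _ R P, hRP, Matrix.one_mulVec]
    | zero => simp
    | add x y _ _ h h' => rw [Matrix.mulVec_add]; exact Submodule.add_mem _ h h'
    | smul c x _ h => rw [Matrix.mulVec_smul]; exact Submodule.smul_mem _ c h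
  intro y _
  have := key _ (hP y)
  rwa [Matrix.mulVec_mulVec, hRP, Matrix.one_mulVec] at this

/-- Reversal turns the arrow around. An intertwiner out of the reversed automaton becomes one into
the original automaton. -/
theorem Intertwines.transpose {A B : WFA K} {G : Matrix (Fin A.transpose.dim) (Fin B.dim) K}
    (h : A.transpose.Intertwines B G) : B.transpose.Intertwines A G.transpose := by
  obtain ⟨hl, hI, hF, hM⟩ := h
  refine ⟨hl.symm, ?_, ?_, fun a ha => ?_⟩
  · have := congrArg Matrix.transpose hF
    rw [Matrix.transpose_mul] at this
    exact this
  · have := congrArg Matrix.transpose hI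
    rw [Matrix.transpose_mul] at this
    exact this
  · have := congrArg Matrix.transpose (hM a (hl.symm ▸ ha))
    rw [Matrix.transpose_mul, Matrix.transpose_mul, A.transpose_matAt] at this
    rw [B.transpose_matAt]
    exact this.symm

/-- Every automaton has a minimal one with the same word function, related to it by two
intertwining matrices. -/
theorem exists_isMinimal_intertwines (A : WFA K) : ∃ (T B : WFA K)
    (G : Matrix (Fin T.dim) (Fin A.dim) K) (H : Matrix (Fin T.dim) (Fin B.dim) K),
    T.Intertwines A G ∧ T.Intertwines B H ∧ B.IsMinimal := by
  -- Right-minimizing the reversal makes `T.transpose` left minimal; the second right minimization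
  -- preserves that. The two intertwiners point in different directions, so `A` and `B` are linked
  -- only through the intermediate automaton.
  obtain ⟨T, G, hG, hT, -⟩ := A.transpose.exists_isRightMinimal
  obtain ⟨B, H, hH, hB, hl⟩ := T.transpose.exists_isRightMinimal
  exact ⟨T.transpose, B, _, H, hG.transpose, hH, hl (isLeftMinimal_transpose_iff.2 hT), hB⟩

end Field

/-! ### Minimization by searching for certificates -/

theorem _root_.ComputablePred.intertwines {α K : Type*} [Primcodable α] [Field K] [Primcodable K]
    (hadd : Computable₂ fun x y : K => x + y) (hmul : Computable₂ fun x y : K => x * y)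
    {S T : α → WFA K} {l : α → List (List K)} (hS : Computable S) (hT : Computable T)
    (hl : Computable l) : ComputablePred fun a =>
      (S a).Intertwines (T a) (Matrix.ofLists _ _ (l a)) := by
  have hG : ComputableMatrix fun a => Matrix.ofLists (S a).dim (T a).dim (l a) :=
    ComputableMatrix.ofLists hl
  have hSd := computable_dim.comp hS
  have hTd := computable_dim.comp hT
  refine (ComputablePred.eq (computable_letters.comp hS) (computable_letters.comp hT)).and
    (.and ?_ (.and ?_ (.ball_lt (computable_letters.comp hS) ?_)))
  · exact ComputableMatrix.eq (Computable.const 1) hTd (computable_initRow.comp hT)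
      (ComputableMatrix.mul hadd hmul hSd (computable_initRow.comp hS) hG)
  · exact ComputableMatrix.eq hSd (Computable.const 1) (computable_finalCol.comp hS)
      (ComputableMatrix.mul hadd hmul hTd hG (computable_finalCol.comp hT))
  · have hSd' := hSd.comp (Computable.fst (β := ℕ))
    have hTd' := hTd.comp (Computable.fst (β := ℕ))
    exact ComputableMatrix.eq hSd' hTd' (ComputableMatrix.mul hadd hmul hSd'
      (computable_matAt.comp ((hS.comp Computable.fst).pair Computable.snd))
      (hG.comp Computable.fst)) (ComputableMatrix.mul hadd hmul hTd' (hG.comp Computable.fst)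
      (computable_matAt.comp ((hT.comp Computable.fst).pair Computable.snd)))

/-- Minimization is computable. -/
theorem exists_computable_minimize {K : Type*} [Field K] [Primcodable K]
    (hadd : Computable₂ fun x y : K => x + y) (hmul : Computable₂ fun x y : K => x * y) :
    ∃ g : WFA K → WFA K, Computable g ∧ ∀ A, (g A).IsMinimal ∧ A.SameWordFunction (g A) := by
  let L := List (List K)
  -- The search runs over the minimal automaton `y.1.1`, the intermediate one `y.1.2`, lists for the
  -- two intertwiners, and certificates of left and of right minimality.
  let p : WFA K → (WFA K × WFA K) × (L × L) × (L × L) × (L × L) → Prop := fun A y =>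
    y.1.2.Intertwines A (Matrix.ofLists _ _ y.2.1.1) ∧
    y.1.2.Intertwines y.1.1 (Matrix.ofLists _ _ y.2.1.2) ∧
    IsReachCertificate y.1.1.letters y.1.1.matAt y.1.1.initRow y.2.2.1 ∧
    IsReachCertificate y.1.1.letters (fun a => (y.1.1.matAt a).transpose)
      y.1.1.finalCol.transpose y.2.2.2
  have hp : ComputablePred fun x : WFA K × ((WFA K × WFA K) × (L × L) × (L × L) × (L × L)) =>
      p x.1 x.2 := by
    have hy : Computable fun x : WFA K × ((WFA K × WFA K) × (L × L) × (L × L) × (L × L)) => x.2 :=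
      Computable.snd
    have hT := Computable.snd.comp (Computable.fst.comp hy)
    have hB := Computable.fst.comp (Computable.fst.comp hy)
    have hBM : ComputableMatrix (n := fun x => x.1.2.1.1.dim) (m := fun x => x.1.2.1.1.dim)
        fun x : (WFA K × ((WFA K × WFA K) × (L × L) × (L × L) × (L × L))) × ℕ =>
          x.1.2.1.1.matAt x.2 :=
      computable_matAt.comp ((hB.comp Computable.fst).pair Computable.snd)
    refine (ComputablePred.intertwines hadd hmul hT Computable.fst
      (Computable.fst.comp (Computable.fst.comp (Computable.snd.comp hy)))).and
      ((ComputablePred.intertwines hadd hmul hT hB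
        (Computable.snd.comp (Computable.fst.comp (Computable.snd.comp hy)))).and
      (.and ?_ ?_))
    · exact .isReachCertificate hadd hmul (computable_dim.comp hB) (computable_letters.comp hB) hBM
        (computable_initRow.comp hB)
        (Computable.fst.comp (Computable.snd.comp (Computable.snd.comp hy)))
    · exact .isReachCertificate hadd hmul (computable_dim.comp hB) (computable_letters.comp hB)
        hBM.transpose (computable_finalCol.comp hB).transpose
        (Computable.snd.comp (Computable.snd.comp (Computable.snd.comp hy)))
  obtain ⟨g, hg, hgp⟩ := ComputablePred.exists_computable_choice hp fun A => by
    obtain ⟨T, B, G, H, hG, hH, hB⟩ := A.exists_isMinimal_intertwines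
    obtain ⟨l, hl⟩ := Matrix.exists_ofLists G
    obtain ⟨l', hl'⟩ := Matrix.exists_ofLists H
    obtain ⟨c, hc⟩ := isLeftMinimal_iff_exists_certificate.1 hB.1
    obtain ⟨c', hc'⟩ := isRightMinimal_iff_exists_certificate.1 hB.2
    refine ⟨((B, T), (l, l'), c, c'), ?_, ?_, hc, hc'⟩
    · exact hl.symm ▸ hG
    · exact hl'.symm ▸ hH
  refine ⟨fun A => (g A).1.1, Computable.fst.comp (Computable.fst.comp hg), fun A => ?_⟩
  obtain ⟨h1, h2, h3, h4⟩ := hgp A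
  exact ⟨⟨isLeftMinimal_iff_exists_certificate.2 ⟨_, h3⟩,
    isRightMinimal_iff_exists_certificate.2 ⟨_, h4⟩⟩,
    h1.sameWordFunction.symm.trans h2.sameWordFunction⟩

end WFA

/-! ### The column space of the differences `A_a - 1` -/

section Increments

variable {K : Type*} [Field K]

/-- A basis `P` of the space spanned by the columns of the matrices `A_a - 1`, with a left inverse
`R`, the action `B_a` of the `A_a` on this space, and coefficients `Y_a`. -/
theorem exists_increment_factorization {k n : ℕ} (A : Fin k → Matrix (Fin n) (Fin n) K) :
    ∃ (d : ℕ) (P : Matrix (Fin n) (Fin d) K) (R : Matrix (Fin d) (Fin n) K)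
      (B : Fin k → Matrix (Fin d) (Fin d) K) (Y : Fin k → Matrix (Fin n) (Fin d) K),
      R * P = 1 ∧ (∀ a, P * R * (A a - 1) = A a - 1) ∧ (∀ a, A a * P = P * B a) ∧
      P = ∑ a, (A a - 1) * Y a := by
  -- The range of `φ` is the span of all columns of the `A_a - 1`; preimages of the columns of `P`
  -- later give the `Y_a`.
  let φ : (Fin k → Fin n → K) →ₗ[K] (Fin n → K) :=
    ∑ a, (A a - 1).mulVecLin ∘ₗ LinearMap.proj a
  have hφ : ∀ y, φ y = ∑ a, (A a - 1).mulVec (y a) := fun y => by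
    simp only [φ, LinearMap.sum_apply, LinearMap.comp_apply, LinearMap.proj_apply,
      Matrix.mulVecLin_apply]
  obtain ⟨d, P, R, hRP, hPR, hP⟩ := (LinearMap.range φ).exists_matrix_retraction
  have hmem : ∀ a x, (A a - 1).mulVec x ∈ LinearMap.range φ := by
    intro a x
    refine ⟨Pi.single a x, ?_⟩
    rw [hφ, Finset.sum_eq_single a (fun b _ hb => by simp [Pi.single_eq_of_ne hb]) (by simp),
      Pi.single_eq_same]
  have hA : ∀ a, P * R * (A a - 1) = A a - 1 := fun a =>
    Matrix.ext_of_mulVec_single fun i => by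
      rw [← Matrix.mulVec_mulVec, ← Matrix.mulVec_mulVec, hPR _ (hmem a _)]
  choose y hy using fun j => hP (Pi.single j 1)
  -- `P R` fixes the columns of `A_a - 1`, so `P (1 + R (A_a - 1) P) = P + (A_a - 1) P = A_a P`.
  refine ⟨d, P, R, fun a => 1 + R * (A a - 1) * P, fun a => Matrix.of fun i j => y j a i, hRP, hA,
    fun a => ?_, ?_⟩
  · rw [Matrix.mul_add, ← Matrix.mul_assoc, ← Matrix.mul_assoc, hA, Matrix.sub_mul,
      Matrix.mul_one, Matrix.one_mul, add_sub_cancel]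
  · refine Matrix.ext_of_mulVec_single fun j => ?_
    rw [← hy, hφ, Matrix.sum_mulVec]
    refine Finset.sum_congr rfl fun a _ => ?_
    rw [← Matrix.mulVec_mulVec]
    congr 1
    ext i
    simp

end Increments

/-! ### Matrices with a common fixed row in canonical position -/

namespace Matrix

variable (R : Type*) [CommRing R]

/-- The rectangular matrix with ones on the diagonal. -/
def rectOne (n m : ℕ) : Matrix (Fin n) (Fin m) R :=
  fun i j => if (i : ℕ) = j then 1 else 0

/-- The unit row with a one at position `d`. -/
def unitRow (n d : ℕ) : Matrix (Fin 1) (Fin n) R :=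
  fun _ j => if (j : ℕ) = d then 1 else 0

variable {R} {l d : ℕ}

theorem mul_rectOne_apply (X : Matrix (Fin l) (Fin (d + 1)) R) (i : Fin l) (j : Fin d) :
    (X * rectOne R (d + 1) d) i j = X i j.castSucc := by
  rw [mul_apply, Fin.sum_univ_castSucc]
  have h : ∀ j : Fin d, d ≠ (j : ℕ) := fun j => j.2.ne'
  simp [rectOne, ← Fin.ext_iff, h]

theorem rectOne_mul_castSucc (X : Matrix (Fin d) (Fin l) R) (i : Fin d) (j : Fin l) :
    (rectOne R (d + 1) d * X) i.castSucc j = X i j := by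
  simp [mul_apply, rectOne, ← Fin.ext_iff]

theorem rectOne_mul_last (X : Matrix (Fin d) (Fin l) R) (j : Fin l) :
    (rectOne R (d + 1) d * X) (Fin.last d) j = 0 := by
  have h : ∀ j : Fin d, d ≠ (j : ℕ) := fun j => j.2.ne'
  simp [mul_apply, rectOne, h]

theorem unitRow_mul_apply (X : Matrix (Fin (d + 1)) (Fin l) R) (i : Fin 1) (j : Fin l) :
    (unitRow R (d + 1) d * X) i j = X (Fin.last d) j := by
  rw [mul_apply, Fin.sum_univ_castSucc]
  have h : ∀ j : Fin d, (j : ℕ) ≠ d := fun j => j.2.ne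
  simp [unitRow, h]

theorem unitRow_apply_last (i : Fin 1) : unitRow R (d + 1) d i (Fin.last d) = 1 := by
  simp [unitRow]

theorem unitRow_apply_castSucc (i : Fin 1) (j : Fin d) :
    unitRow R (d + 1) d i j.castSucc = 0 := by
  simp [unitRow, j.2.ne]

theorem rectOne_transpose_mul : (rectOne R (d + 1) d).transpose * rectOne R (d + 1) d =
    (1 : Matrix (Fin d) (Fin d) R) := by
  ext i j
  rw [mul_rectOne_apply]
  simp [rectOne, one_apply, Fin.ext_iff, eq_comm]

theorem unitRow_mul_rectOne : unitRow R (d + 1) d * rectOne R (d + 1) d =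
    (0 : Matrix (Fin 1) (Fin d) R) := by
  ext i j
  rw [mul_rectOne_apply, unitRow_apply_castSucc, zero_apply]

/-- The projection onto the first `d` coordinates, written as the identity minus its last diagonal
entry. With this, blocks are handled by matrix products, and certificates can be stated before the
size is known to have the form `d + 1`. -/
theorem rectOne_mul_transpose : rectOne R (d + 1) d * (rectOne R (d + 1) d).transpose =
    (1 : Matrix (Fin (d + 1)) (Fin (d + 1)) R) -
      (unitRow R (d + 1) d).transpose * unitRow R (d + 1) d := by
  ext i j
  rw [sub_apply, mul_apply (M := (unitRow R (d + 1) d).transpose), Fin.sum_univ_one]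
  have h : ∀ j : Fin d, (j : ℕ) ≠ d := fun j => j.2.ne
  have h' : ∀ j : Fin d, d ≠ (j : ℕ) := fun j => j.2.ne'
  refine Fin.lastCases ?_ (fun i => ?_) i
  · rw [rectOne_mul_last]
    refine Fin.lastCases ?_ (fun j => ?_) j <;>
      simp [unitRow, h, h', Fin.ext_iff]
  · rw [rectOne_mul_castSucc]
    simp [unitRow, rectOne, one_apply, h, Fin.ext_iff, eq_comm]

end Matrix

namespace MatrixFamily

/-- Turns two product identities, for the first `d` columns and for the last row, into the block
form; the remaining entries of the last column are free and define `b`. -/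
theorem bordered_mat_eq {R : Type*} [CommRing R] {k d : ℕ} (B : Fin k → Matrix (Fin d) (Fin d) R)
    (b : Fin k → Fin d → R) (a : Fin k) (X : Matrix (Fin (d + 1)) (Fin (d + 1)) R)
    (hX : X * Matrix.rectOne R (d + 1) d = Matrix.rectOne R (d + 1) d * B a)
    (hrow : Matrix.unitRow R (d + 1) d * X = Matrix.unitRow R (d + 1) d)
    (hb : ∀ i : Fin d, b a i = X i.castSucc (Fin.last d)) :
    X = ((MatrixFamily.mk k d B).bordered b).mat a := by
  have hinl : ∀ i : Fin d, finSumFinEquiv.symm i.castSucc = (Sum.inl i : Fin d ⊕ Fin 1) :=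
    fun i => finSumFinEquiv_symm_apply_castAdd i
  have hinr : finSumFinEquiv.symm (Fin.last d) = (Sum.inr 0 : Fin d ⊕ Fin 1) :=
    finSumFinEquiv_symm_apply_natAdd (m := d) (0 : Fin 1)
  change X = Matrix.reindex finSumFinEquiv finSumFinEquiv
    (Matrix.fromBlocks (B a) (Matrix.of fun i (_ : Fin 1) => b a i) 0 1)
  ext i j
  rw [Matrix.reindex_apply, Matrix.submatrix_apply]
  have hX' := fun i j => congrFun (congrFun hX i) j
  have hrow' := fun j => congrFun (congrFun hrow 0) j
  simp only [Matrix.mul_rectOne_apply, Matrix.unitRow_mul_apply] at hX' hrow'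
  refine Fin.lastCases ?_ (fun i => ?_) i <;> refine Fin.lastCases ?_ (fun j => ?_) j
  · rw [hrow', hinr, Matrix.fromBlocks_apply₂₂, Matrix.unitRow_apply_last, Matrix.one_apply_eq]
  · rw [hrow', hinr, hinl, Matrix.fromBlocks_apply₂₁, Matrix.unitRow_apply_castSucc,
      Matrix.zero_apply]
  · rw [hinr, hinl, Matrix.fromBlocks_apply₁₂, Matrix.of_apply, hb]
  · rw [hX', hinl, hinl, Matrix.fromBlocks_apply₁₁, Matrix.rectOne_mul_castSucc]

/-- The matrices `A_a` have a common nonzero fixed row `c`, and they act by the `B_a` on the column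
space of `P`, which lies in the kernel of `c` and contains the columns of the `A_a - 1`. -/
def IsFixedRowReduction {K : Type*} [Field K] (A B : MatrixFamily K) : Prop :=
  B.letters = A.letters ∧ ∃ (P : Matrix (Fin A.dim) (Fin B.dim) K)
    (R : Matrix (Fin B.dim) (Fin A.dim) K) (c : Matrix (Fin 1) (Fin A.dim) K),
    R * P = 1 ∧ c ≠ 0 ∧ c * P = 0 ∧ ∀ a < A.letters, P * R * (A.matAt a - 1) = A.matAt a - 1 ∧
      A.matAt a * P = P * B.matAt a ∧ c * A.matAt a = c

end MatrixFamily

/-- Put `c` in place of row `p` of the identity, where `c_p ≠ 0`; the determinant becomes `c_p`.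
Then swap row `p` with the last row. -/
theorem Matrix.exists_invertible_last_row {K : Type*} [Field K] {d : ℕ}
    (c : Matrix (Fin 1) (Fin (d + 1)) K) (hc : c ≠ 0) :
    ∃ N : Matrix (Fin (d + 1)) (Fin (d + 1)) K, IsUnit N.det ∧ Matrix.unitRow K (d + 1) d * N = c := by
  obtain ⟨p, hp⟩ : ∃ p, c 0 p ≠ 0 := by
    by_contra! h
    refine hc ?_
    ext i j
    rw [Subsingleton.elim i 0, h j, Matrix.zero_apply]
  let U : Matrix (Fin (d + 1)) (Fin (d + 1)) K := Matrix.updateRow 1 p (c 0)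
  have hU : U.det = c 0 p := by
    -- Cramer's rule for the identity matrix, read as a formula for the determinant.
    have := Matrix.cramer_transpose_apply (1 : Matrix (Fin (d + 1)) (Fin (d + 1)) K) (c 0) p
    rw [Matrix.transpose_one, Matrix.cramer_one] at this
    exact this.symm
  refine ⟨U.submatrix (Equiv.swap p (Fin.last d)) id, ?_, ?_⟩
  · rw [Matrix.det_permute, hU]
    exact ((Equiv.Perm.sign (Equiv.swap p (Fin.last d))).isUnit.map (Int.castRingHom K)).mul
      (isUnit_iff_ne_zero.2 hp)
  · ext i j
    rw [Matrix.unitRow_mul_apply, Subsingleton.elim i 0]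
    simp [U]

/-! ### Canonical forms and reductions are computable -/

namespace ComputableMatrix

variable {α K : Type*} [Primcodable α] [CommRing K] [Primcodable K] {n m : α → ℕ}

theorem rectOne : ComputableMatrix (n := n) (m := m) fun a => Matrix.rectOne K (n a) (m a) :=
  ⟨fun x => if x.2.1 = x.2.2 then 1 else 0, Computable.ite
    (ComputablePred.eq (Computable.fst.comp Computable.snd) (Computable.snd.comp Computable.snd))
    (Computable.const 1) (Computable.const 0), fun _ _ _ => rfl⟩

theorem unitRow (hm : Computable m) :
    ComputableMatrix (n := fun _ => 1) (m := n) fun a => Matrix.unitRow K (n a) (m a) :=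
  ⟨fun x => if x.2.2 = m x.1 then 1 else 0, Computable.ite
    (ComputablePred.eq (Computable.snd.comp Computable.snd) (hm.comp Computable.fst))
    (Computable.const 1) (Computable.const 0), fun _ _ _ => rfl⟩

end ComputableMatrix

/-- The last row of `C` is the unit row, so `C * rectOne` has a zero last row and the projection
onto the first `d` coordinates leaves it unchanged. -/
theorem Matrix.rectOne_mul_of_fixed {K : Type*} [CommRing K] {d : ℕ}
    {C : Matrix (Fin (d + 1)) (Fin (d + 1)) K} (hC : unitRow K (d + 1) d * C = unitRow K (d + 1) d) :
    rectOne K (d + 1) d * ((rectOne K (d + 1) d).transpose * C * rectOne K (d + 1) d) =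
      C * rectOne K (d + 1) d := by
  rw [Matrix.mul_assoc, ← Matrix.mul_assoc, rectOne_mul_transpose, Matrix.sub_mul, Matrix.one_mul,
    Matrix.mul_assoc _ _ (C * _), ← Matrix.mul_assoc _ C, hC, unitRow_mul_rectOne, Matrix.mul_zero,
    sub_zero]

/-- In the basis given by `M`, the fixed row is the last coordinate `c = unitRow * N`, and the first
`d` columns of `M` are a basis of its kernel. With `P` and `R` the corresponding inclusion and
retraction, `1 - P R` factors through `c`, and `c (T - 1) = 0` gives `P R (T - 1) = T - 1`. -/
theorem Matrix.fixedRow_reduction {K : Type*} [Field K] {n d : ℕ}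
    {M : Matrix (Fin n) (Fin (d + 1)) K} {N : Matrix (Fin (d + 1)) (Fin n) K} (hNM : N * M = 1)
    (hMN : M * N = 1) :
    (rectOne K (d + 1) d).transpose * N * (M * rectOne K (d + 1) d) = 1 ∧
    unitRow K (d + 1) d * N ≠ 0 ∧
    unitRow K (d + 1) d * N * (M * rectOne K (d + 1) d) = 0 ∧
    ∀ {T : Matrix (Fin n) (Fin n) K} {C : Matrix (Fin (d + 1)) (Fin (d + 1)) K}
      {B : Matrix (Fin d) (Fin d) K}, T * M = M * C →
      C * rectOne K (d + 1) d = rectOne K (d + 1) d * B →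
      unitRow K (d + 1) d * C = unitRow K (d + 1) d →
      M * rectOne K (d + 1) d * ((rectOne K (d + 1) d).transpose * N) * (T - 1) = T - 1 ∧
      T * (M * rectOne K (d + 1) d) = M * rectOne K (d + 1) d * B ∧
      unitRow K (d + 1) d * N * T = unitRow K (d + 1) d * N := by
  refine ⟨?_, fun h0 => ?_, ?_, fun {T C B} hT hE he => ?_⟩
  · rw [Matrix.mul_assoc, ← Matrix.mul_assoc N, hNM, Matrix.one_mul, rectOne_transpose_mul]
  · have h1 : unitRow K (d + 1) d * N * M = 0 := by rw [h0, Matrix.zero_mul]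
    rw [Matrix.mul_assoc, hNM, Matrix.mul_one] at h1
    have h2 := congrFun (congrFun h1 0) (Fin.last _)
    rw [unitRow_apply_last] at h2
    exact one_ne_zero h2
  · rw [Matrix.mul_assoc, ← Matrix.mul_assoc N, hNM, Matrix.one_mul, unitRow_mul_rectOne]
  · have hN : N * T = C * N := by
      rw [← Matrix.mul_one (N * T), ← hMN, ← Matrix.mul_assoc, Matrix.mul_assoc N, hT,
        ← Matrix.mul_assoc, hNM, Matrix.one_mul]
    have hc : unitRow K (d + 1) d * N * T = unitRow K (d + 1) d * N := by
      rw [Matrix.mul_assoc, hN, ← Matrix.mul_assoc, he]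
    refine ⟨?_, ?_, hc⟩
    · have h1 : M * rectOne K (d + 1) d * ((rectOne K (d + 1) d).transpose * N) =
          1 - M * (unitRow K (d + 1) d).transpose * (unitRow K (d + 1) d * N) := by
        rw [Matrix.mul_assoc, ← Matrix.mul_assoc (rectOne K (d + 1) d), rectOne_mul_transpose,
          Matrix.sub_mul, Matrix.mul_sub, Matrix.one_mul, hMN]
        simp only [Matrix.mul_assoc]
      rw [h1, Matrix.sub_mul, Matrix.one_mul, Matrix.mul_assoc _ _ (T - 1),
        Matrix.mul_sub _ T, hc, Matrix.mul_one, sub_self, Matrix.mul_zero, sub_zero]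
    · rw [← Matrix.mul_assoc, hT, Matrix.mul_assoc, hE, Matrix.mul_assoc]

namespace WFA

section Field

variable {K : Type*} [Field K]

/-- The matrices `M` and `N = M⁻¹` transform the automaton `A` into `C`, and the weight matrices
of `C` are the `B_a` with an additional column and an additional last row of the unit matrix. -/
def IsCanonicalCertificate (A C : WFA K) (B : MatrixFamily K)
    (M : Matrix (Fin A.dim) (Fin C.dim) K) (N : Matrix (Fin C.dim) (Fin A.dim) K) : Prop :=
  A.Intertwines C M ∧ C.dim = A.dim ∧ N * M = 1 ∧ M * N = 1 ∧ C.letters = B.letters ∧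
    C.dim = B.dim + 1 ∧ ∀ a < C.letters,
      C.matAt a * Matrix.rectOne K C.dim B.dim = Matrix.rectOne K C.dim B.dim * B.matAt a ∧
      Matrix.unitRow K C.dim B.dim * C.matAt a = Matrix.unitRow K C.dim B.dim

theorem IsCanonicalCertificate.isCanonicalForm {A C : WFA K} {B : MatrixFamily K}
    {M : Matrix (Fin A.dim) (Fin C.dim) K} {N : Matrix (Fin C.dim) (Fin A.dim) K}
    (h : A.IsCanonicalCertificate C B M N) : A.IsCanonicalForm C B := by
  obtain ⟨⟨k, n, MA⟩, I, F⟩ := A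
  obtain ⟨⟨k', n', MC⟩, I', F'⟩ := C
  obtain ⟨k'', d, MB⟩ := B
  obtain ⟨⟨hl, hI, hF, hM⟩, hn, hNM, hMN, hl', hd, hB⟩ := h
  dsimp only at hl hn hl' hd hM hB M N hNM hMN
  subst hl hn hl' hd
  have hM' : ∀ a, MA a * M = M * MC a := fun a => by
    simpa [MatrixFamily.matAt] using hM a a.2
  have hB' : ∀ a : Fin k, MC a * Matrix.rectOne K (d + 1) d = Matrix.rectOne K (d + 1) d * MB a ∧
      Matrix.unitRow K (d + 1) d * MC a = Matrix.unitRow K (d + 1) d := fun a => by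
    simpa [MatrixFamily.matAt] using hB a a.2
  have hinv : M⁻¹ = N := Matrix.inv_eq_left_inv hNM
  have hI' : I' = Matrix.vecMul I M := congrFun hI 0
  have hF' : F = M.mulVec F' := funext fun i => congrFun (congrFun hF i) 0
  refine ⟨⟨M, (Matrix.isUnit_iff_isUnit_det M).1 ⟨⟨M, N, hMN, hNM⟩, rfl⟩, ?_⟩,
    fun a i => MC a i.castSucc (Fin.last d), ?_⟩
  · have h1 : MC = fun a => M⁻¹ * MA a * M := funext fun a => by
      rw [hinv, Matrix.mul_assoc, hM', ← Matrix.mul_assoc, hNM, Matrix.one_mul]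
    have h2 : F' = M⁻¹.mulVec F := by
      rw [hinv, hF', Matrix.mulVec_mulVec, hNM, Matrix.one_mulVec]
    rw [hI', h2, h1]
    rfl
  · have h1 : MC = ((MatrixFamily.mk k d MB).bordered
        fun a i => MC a i.castSucc (Fin.last d)).mat := funext fun a =>
      MatrixFamily.bordered_mat_eq MB _ a (MC a) (hB' a).1 (hB' a).2 fun _ => rfl
    exact congrArg (MatrixFamily.mk k (d + 1)) h1

theorem IsCanonicalCertificate.isFixedRowReduction {A C : WFA K} {B : MatrixFamily K}
    {M : Matrix (Fin A.dim) (Fin C.dim) K} {N : Matrix (Fin C.dim) (Fin A.dim) K}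
    (h : A.IsCanonicalCertificate C B M N) : A.toMatrixFamily.IsFixedRowReduction B := by
  obtain ⟨⟨⟨k', n', MC⟩, I', F'⟩, hC⟩ : ∃ C' : WFA K, C' = C := ⟨C, rfl⟩
  obtain ⟨d, hd⟩ : ∃ d, d = B.dim := ⟨_, rfl⟩
  subst hC
  obtain ⟨⟨hl, hI, hF, hM⟩, hn, hNM, hMN, hl', hd', hB⟩ := h
  dsimp only at hl hn hl' hd' hM hB M N hNM hMN
  subst hd'
  obtain ⟨h1, h2, h3, h4⟩ := Matrix.fixedRow_reduction hNM hMN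
  exact ⟨hl'.symm.trans hl.symm, _, _, _, h1, h2, h3, fun a ha =>
    h4 (hM a ha) (hB a (hl ▸ ha)).1 (hB a (hl ▸ ha)).2⟩

/-- Either the columns of the matrices `A_a - 1` span the whole space, or there is a canonical
form. -/
theorem exists_canonicalCertificate (A : WFA K) :
    (∃ X : Fin A.letters → Matrix (Fin A.dim) (Fin A.dim) K, ∑ a, (A.mat a - 1) * X a = 1) ∨
    ∃ C B M N, A.IsCanonicalCertificate C B M N := by
  obtain ⟨⟨k, n, MA⟩, I, F⟩ := A
  obtain ⟨m, P, R, -, Y, hRP, hPR, -, hY⟩ := exists_increment_factorization MA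
  -- `P R` is a projection onto the span of the columns of the `A_a - 1`, so it is the identity
  -- exactly when they span everything.
  by_cases h1 : P * R = 1
  · left
    refine ⟨fun a => Y a * R, ?_⟩
    refine Eq.trans ?_ h1
    conv_rhs => rw [hY, Matrix.sum_mul]
    exact Finset.sum_congr rfl fun a _ => (Matrix.mul_assoc _ _ _).symm
  · right
    obtain ⟨i, hi⟩ : ∃ i, (1 - P * R : Matrix (Fin n) (Fin n) K) i ≠ 0 := by
      by_contra! h
      exact h1 (sub_eq_zero.1 (funext h)).symm
    -- Every row of `1 - P R` annihilates the columns of the `A_a - 1`, so a nonzero one is a common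
    -- fixed row.
    let c : Matrix (Fin 1) (Fin n) K := fun _ => (1 - P * R : Matrix (Fin n) (Fin n) K) i
    have hc0 : c ≠ 0 := fun h => hi (congrFun h 0)
    have hc : ∀ a, c * MA a = c := by
      intro a
      have h2 : c * (MA a - 1) = 0 := by
        have h3 : (1 - P * R) * (MA a - 1) = 0 := by
          rw [Matrix.sub_mul, Matrix.one_mul, hPR, sub_self]
        ext s t
        exact congrFun (congrFun h3 i) t
      rwa [Matrix.mul_sub, Matrix.mul_one, sub_eq_zero] at h2
    obtain ⟨d, rfl⟩ : ∃ d, n = d + 1 := by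
      cases n with
      | zero => exact absurd (Subsingleton.elim c 0) hc0
      | succ d => exact ⟨d, rfl⟩
    obtain ⟨N, hN, hrow⟩ := Matrix.exists_invertible_last_row c hc0
    have hNN : N * N⁻¹ = 1 := Matrix.mul_nonsing_inv N hN
    have hNN' : N⁻¹ * N = 1 := Matrix.nonsing_inv_mul N hN
    let C : Fin k → Matrix (Fin (d + 1)) (Fin (d + 1)) K := fun a => N * MA a * N⁻¹
    have hfix : ∀ a, Matrix.unitRow K (d + 1) d * C a = Matrix.unitRow K (d + 1) d := by
      intro a
      simp only [C]
      rw [← Matrix.mul_assoc, ← Matrix.mul_assoc, hrow, hc, ← hrow, Matrix.mul_assoc, hNN,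
        Matrix.mul_one]
    refine ⟨⟨⟨k, d + 1, C⟩, Matrix.vecMul I N⁻¹, N.mulVec F⟩,
      ⟨k, d, fun a => (Matrix.rectOne K (d + 1) d).transpose * C a * Matrix.rectOne K (d + 1) d⟩, N⁻¹, N,
      ⟨rfl, rfl, ?_, fun a ha => ?_⟩, rfl, hNN, hNN', rfl, rfl, fun a ha => ?_⟩
    · have h2 : F = N⁻¹.mulVec (N.mulVec F) := by
        rw [Matrix.mulVec_mulVec, hNN', Matrix.one_mulVec]
      ext i j
      exact congrFun h2 i
    · dsimp only at ha
      simp only [MatrixFamily.matAt, ha, dif_pos, C]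
      rw [← Matrix.mul_assoc, ← Matrix.mul_assoc, hNN', Matrix.one_mul]
    · dsimp only at ha
      simp only [MatrixFamily.matAt, ha, dif_pos]
      exact ⟨(Matrix.rectOne_mul_of_fixed (hfix _)).symm, hfix _⟩

end Field

/-! ### Canonical forms and the increment reduction by search -/

theorem sum_matAt {R M : Type*} [Semiring R] [AddCommMonoid M] (A : MatrixFamily R)
    (f : ℕ → Matrix (Fin A.dim) (Fin A.dim) R → M) :
    ∑ a ∈ Finset.range A.letters, f a (A.matAt a) = ∑ a : Fin A.letters, f a (A.mat a) := by
  rw [← Fin.sum_univ_eq_sum_range (fun a => f a (A.matAt a))]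
  simp only [MatrixFamily.matAt_coe]

/-- The canonical form is computable, and so is the question whether it exists. -/
theorem exists_computable_canonicalForm {K : Type*} [Field K] [Primcodable K]
    (hadd : Computable₂ fun x y : K => x + y) (hmul : Computable₂ fun x y : K => x * y) :
    ∃ g : WFA K → Option (WFA K × MatrixFamily K), Computable g ∧ ∀ A,
      (g A = none → ∃ X : Fin A.letters → Matrix (Fin A.dim) (Fin A.dim) K,
        ∑ a, (A.mat a - 1) * X a = 1) ∧
      ∀ C B, g A = some (C, B) → A.IsCanonicalForm C B ∧
        A.toMatrixFamily.IsFixedRowReduction B := by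
  let L := List (List K)
  let β := (Bool × WFA K × MatrixFamily K) × (L × L) × List L
  -- The flag `y.1.1` tells which alternative is certified: a canonical form, or matrices `X_a` with
  -- `∑ (A_a - 1) X_a = 1`. The latter is rearranged without subtraction, so that checking takes
  -- only additions and multiplications.
  let p : WFA K → β → Prop := fun A y =>
    (y.1.1 = true ∧ A.IsCanonicalCertificate y.1.2.1 y.1.2.2 (Matrix.ofLists _ _ y.2.1.1)
      (Matrix.ofLists _ _ y.2.1.2)) ∨
    (y.1.1 = false ∧ ∑ a ∈ Finset.range A.letters,
        A.matAt a * Matrix.ofLists A.dim A.dim (y.2.2.getD a []) =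
      1 + ∑ a ∈ Finset.range A.letters, Matrix.ofLists A.dim A.dim (y.2.2.getD a []))
  have hp : ComputablePred fun x : WFA K × β => p x.1 x.2 := by
    have hA : Computable fun x : WFA K × β => x.1 := Computable.fst
    have hy1 : Computable fun x : WFA K × β => x.2.1 := Computable.fst.comp Computable.snd
    have hy2 : Computable fun x : WFA K × β => x.2.2 := Computable.snd.comp Computable.snd
    have hflag : Computable fun x : WFA K × β => x.2.1.1 := Computable.fst.comp hy1
    have hC : Computable fun x : WFA K × β => x.2.1.2.1 :=
      Computable.fst.comp (Computable.snd.comp hy1)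
    have hB : Computable fun x : WFA K × β => x.2.1.2.2 :=
      Computable.snd.comp (Computable.snd.comp hy1)
    have hlM : Computable fun x : WFA K × β => x.2.2.1.1 :=
      Computable.fst.comp (Computable.fst.comp hy2)
    have hlN : Computable fun x : WFA K × β => x.2.2.1.2 :=
      Computable.snd.comp (Computable.fst.comp hy2)
    have hlX : Computable fun x : WFA K × β => x.2.2.2 := Computable.snd.comp hy2
    have hAd := computable_dim.comp hA
    have hCd := computable_dim.comp hC
    have hBd := MatrixFamily.computable_dim.comp hB
    have hCl := computable_letters.comp hC
    have hM : ComputableMatrix fun x : WFA K × β =>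
        Matrix.ofLists x.1.dim x.2.1.2.1.dim x.2.2.1.1 := ComputableMatrix.ofLists hlM
    have hN : ComputableMatrix fun x : WFA K × β =>
        Matrix.ofLists x.2.1.2.1.dim x.1.dim x.2.2.1.2 := ComputableMatrix.ofLists hlN
    have hX : ComputableMatrix (n := fun x => x.1.1.dim) (m := fun x => x.1.1.dim)
        fun x : (WFA K × β) × ℕ => Matrix.ofLists x.1.1.dim x.1.1.dim (x.1.2.2.2.getD x.2 []) :=
      ComputableMatrix.ofLists
        (Computable.list_getD _ (hlX.comp Computable.fst) Computable.snd)
    have hAl := computable_letters.comp hA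
    refine ((ComputablePred.eq hflag (Computable.const true)).and
      ((ComputablePred.intertwines hadd hmul hA hC hlM).and ((ComputablePred.eq hCd hAd).and
      (.and ?_ (.and ?_ ((ComputablePred.eq hCl (MatrixFamily.computable_letters.comp hB)).and
      ((ComputablePred.eq hCd (Computable.succ.comp hBd)).and
      (.ball_lt hCl (.and ?_ ?_))))))))).or
      ((ComputablePred.eq hflag (Computable.const false)).and ?_)
    · exact ComputableMatrix.eq hCd hCd (ComputableMatrix.mul hadd hmul hAd hN hM)
        ComputableMatrix.one
    · exact ComputableMatrix.eq hAd hAd (ComputableMatrix.mul hadd hmul hCd hM hN)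
        ComputableMatrix.one
    · have hf := Computable.fst (α := WFA K × β) (β := ℕ)
      exact ComputableMatrix.eq (hCd.comp hf) (hBd.comp hf)
        (ComputableMatrix.mul hadd hmul (hCd.comp hf)
          (computable_matAt.comp ((hC.comp hf).pair Computable.snd)) ComputableMatrix.rectOne)
        (ComputableMatrix.mul hadd hmul (hBd.comp hf) ComputableMatrix.rectOne
          (MatrixFamily.computable_matAt.comp ((hB.comp hf).pair Computable.snd)))
    · have hf := Computable.fst (α := WFA K × β) (β := ℕ)
      exact ComputableMatrix.eq (Computable.const 1) (hCd.comp hf)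
        (ComputableMatrix.mul hadd hmul (hCd.comp hf) (ComputableMatrix.unitRow (hBd.comp hf))
          (computable_matAt.comp ((hC.comp hf).pair Computable.snd)))
        (ComputableMatrix.unitRow (hBd.comp hf))
    · have hf := Computable.fst (α := WFA K × β) (β := ℕ)
      exact ComputableMatrix.eq hAd hAd (ComputableMatrix.sum_range hadd hAl
        (ComputableMatrix.mul hadd hmul (hAd.comp hf)
          (computable_matAt.comp ((hA.comp hf).pair Computable.snd)) hX))
        (ComputableMatrix.add hadd ComputableMatrix.one (ComputableMatrix.sum_range hadd hAl hX))
  obtain ⟨g, hg, hgp⟩ := ComputablePred.exists_computable_choice hp fun A => by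
    rcases A.exists_canonicalCertificate with ⟨X, hX⟩ | ⟨C, B, M, N, h⟩
    · obtain ⟨l, hl⟩ := Matrix.exists_ofLists_family X
      -- In this branch the automaton, the family and the first two lists are mere fillers.
      refine ⟨((false, A, A.toMatrixFamily), ([], []), l), Or.inr ⟨rfl, ?_⟩⟩
      rw [sum_matAt A.toMatrixFamily fun a Y => Y * Matrix.ofLists A.dim A.dim (l.getD a []),
        ← Fin.sum_univ_eq_sum_range (fun a => Matrix.ofLists A.dim A.dim (l.getD a []))]
      simp only [hl]
      rw [← hX, ← Finset.sum_add_distrib]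
      exact Finset.sum_congr rfl fun a _ => by rw [Matrix.sub_mul, Matrix.one_mul, sub_add_cancel]
    · obtain ⟨l, rfl⟩ := Matrix.exists_ofLists M
      obtain ⟨l', rfl⟩ := Matrix.exists_ofLists N
      exact ⟨((true, C, B), (l, l'), []), Or.inl ⟨rfl, h⟩⟩
  refine ⟨fun A => cond (g A).1.1 (some (g A).1.2) none, Computable.cond
    (Computable.fst.comp (Computable.fst.comp hg))
    (Computable.option_some.comp (Computable.snd.comp (Computable.fst.comp hg)))
    (Computable.const none), fun A => ⟨fun h => ?_, fun C B h => ?_⟩⟩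
  · rcases hgp A with ⟨h1, -⟩ | ⟨-, h2⟩
    · simp [h1] at h
    · refine ⟨fun a => Matrix.ofLists A.dim A.dim ((g A).2.2.getD a []), ?_⟩
      rw [sum_matAt A.toMatrixFamily fun a Y =>
          Y * Matrix.ofLists A.dim A.dim ((g A).2.2.getD a []),
        ← Fin.sum_univ_eq_sum_range
          (fun a => Matrix.ofLists A.dim A.dim ((g A).2.2.getD a []))] at h2
      simp only [Matrix.sub_mul, Matrix.one_mul, Finset.sum_sub_distrib]
      exact sub_eq_iff_eq_add.2 h2
  · rcases hgp A with ⟨h1, h2⟩ | ⟨h1, -⟩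
    · simp only [h1, cond_true, Option.some.injEq] at h
      rw [h] at h2
      exact ⟨h2.isCanonicalForm, h2.isFixedRowReduction⟩
    · simp [h1] at h

end WFA

/-- The matrices `A_a` act by the `B_a` on the space spanned by the columns of the matrices
`A_a - 1`, of which the columns of `P` are a basis. -/
def MatrixFamily.IsIncrementReduction {K : Type*} [Field K] (A B : MatrixFamily K) : Prop :=
  B.letters = A.letters ∧ ∃ (P : Matrix (Fin A.dim) (Fin B.dim) K)
    (R : Matrix (Fin B.dim) (Fin A.dim) K) (Y : ℕ → Matrix (Fin A.dim) (Fin B.dim) K), R * P = 1 ∧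
    (∀ a < A.letters, P * R * A.matAt a + 1 = A.matAt a + P * R ∧
      A.matAt a * P = P * B.matAt a) ∧
    P + ∑ a ∈ Finset.range A.letters, Y a = ∑ a ∈ Finset.range A.letters, A.matAt a * Y a

/-- `exists_increment_factorization` guarantees that the search ends; its identities are again
tested in a form without subtraction. -/
theorem MatrixFamily.exists_computable_incrementReduction {K : Type*} [Field K] [Primcodable K]
    (hadd : Computable₂ fun x y : K => x + y) (hmul : Computable₂ fun x y : K => x * y) :
    ∃ g : MatrixFamily K → MatrixFamily K, Computable g ∧
      ∀ A : MatrixFamily K, A.IsIncrementReduction (g A) := by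
  let L := List (List K)
  let β := MatrixFamily K × (L × L) × List L
  let p : MatrixFamily K → β → Prop := fun A y =>
    y.1.letters = A.letters ∧
    Matrix.ofLists y.1.dim A.dim y.2.1.2 * Matrix.ofLists A.dim y.1.dim y.2.1.1 = 1 ∧
    (∀ a < A.letters, Matrix.ofLists A.dim y.1.dim y.2.1.1 * Matrix.ofLists y.1.dim A.dim y.2.1.2
        * A.matAt a + 1 = A.matAt a + Matrix.ofLists A.dim y.1.dim y.2.1.1 *
          Matrix.ofLists y.1.dim A.dim y.2.1.2 ∧
      A.matAt a * Matrix.ofLists A.dim y.1.dim y.2.1.1 =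
        Matrix.ofLists A.dim y.1.dim y.2.1.1 * y.1.matAt a) ∧
    Matrix.ofLists A.dim y.1.dim y.2.1.1 + ∑ a ∈ Finset.range A.letters,
        Matrix.ofLists A.dim y.1.dim (y.2.2.getD a []) =
      ∑ a ∈ Finset.range A.letters, A.matAt a * Matrix.ofLists A.dim y.1.dim (y.2.2.getD a [])
  have hp : ComputablePred fun x : MatrixFamily K × β => p x.1 x.2 := by
    have hA : Computable fun x : MatrixFamily K × β => x.1 := Computable.fst
    have hB : Computable fun x : MatrixFamily K × β => x.2.1 := Computable.fst.comp Computable.snd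
    have hy2 : Computable fun x : MatrixFamily K × β => x.2.2 := Computable.snd.comp Computable.snd
    have hlP : Computable fun x : MatrixFamily K × β => x.2.2.1.1 :=
      Computable.fst.comp (Computable.fst.comp hy2)
    have hlR : Computable fun x : MatrixFamily K × β => x.2.2.1.2 :=
      Computable.snd.comp (Computable.fst.comp hy2)
    have hlY : Computable fun x : MatrixFamily K × β => x.2.2.2 := Computable.snd.comp hy2
    have hAd := computable_dim.comp hA
    have hBd := computable_dim.comp hB
    have hAl := computable_letters.comp hA
    have hP : ComputableMatrix fun x : MatrixFamily K × β =>
        Matrix.ofLists x.1.dim x.2.1.dim x.2.2.1.1 := ComputableMatrix.ofLists hlP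
    have hR : ComputableMatrix fun x : MatrixFamily K × β =>
        Matrix.ofLists x.2.1.dim x.1.dim x.2.2.1.2 := ComputableMatrix.ofLists hlR
    have hY : ComputableMatrix (n := fun x => x.1.1.dim) (m := fun x => x.1.2.1.dim)
        fun x : (MatrixFamily K × β) × ℕ =>
          Matrix.ofLists x.1.1.dim x.1.2.1.dim (x.1.2.2.2.getD x.2 []) :=
      ComputableMatrix.ofLists
        (Computable.list_getD _ (hlY.comp Computable.fst) Computable.snd)
    have hf := Computable.fst (α := MatrixFamily K × β) (β := ℕ)
    have hAd' := hAd.comp hf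
    have hBd' := hBd.comp hf
    have hAM := computable_matAt.comp ((hA.comp hf).pair Computable.snd)
    have hBM := computable_matAt.comp ((hB.comp hf).pair Computable.snd)
    have hPR := ComputableMatrix.mul hadd hmul hBd' (hP.comp hf) (hR.comp hf)
    refine (ComputablePred.eq (computable_letters.comp hB) hAl).and (.and ?_ (.and
      (.ball_lt hAl (.and ?_ ?_)) ?_))
    · exact ComputableMatrix.eq hBd hBd (ComputableMatrix.mul hadd hmul hAd hR hP)
        ComputableMatrix.one
    · exact ComputableMatrix.eq hAd' hAd' (ComputableMatrix.add hadd
        (ComputableMatrix.mul hadd hmul hAd' hPR hAM) ComputableMatrix.one)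
        (ComputableMatrix.add hadd hAM hPR)
    · exact ComputableMatrix.eq hAd' hBd' (ComputableMatrix.mul hadd hmul hAd' hAM (hP.comp hf))
        (ComputableMatrix.mul hadd hmul hBd' (hP.comp hf) hBM)
    · exact ComputableMatrix.eq hAd hBd
        (ComputableMatrix.add hadd hP (ComputableMatrix.sum_range hadd hAl hY))
        (ComputableMatrix.sum_range hadd hAl (ComputableMatrix.mul hadd hmul hAd' hAM hY))
  obtain ⟨g, hg, hgp⟩ := ComputablePred.exists_computable_choice hp fun A => by
    obtain ⟨d, P, R, B, Y, hRP, hPR, hB, hY⟩ := exists_increment_factorization A.mat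
    obtain ⟨l, rfl⟩ := Matrix.exists_ofLists P
    obtain ⟨l', rfl⟩ := Matrix.exists_ofLists R
    obtain ⟨t, ht⟩ := Matrix.exists_ofLists_family Y
    refine ⟨(⟨A.letters, d, B⟩, (l, l'), t), rfl, hRP, fun a ha => ⟨?_, ?_⟩, ?_⟩
    · have h1 := hPR ⟨a, ha⟩
      rw [Matrix.mul_sub, Matrix.mul_one, sub_eq_sub_iff_add_eq_add] at h1
      simpa only [MatrixFamily.matAt, ha, dif_pos] using h1
    · simp only [MatrixFamily.matAt, ha, dif_pos]
      exact hB _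
    · rw [WFA.sum_matAt A fun a X => X * Matrix.ofLists A.dim d (t.getD a []),
        ← Fin.sum_univ_eq_sum_range (fun a => Matrix.ofLists A.dim d (t.getD a []))]
      simp only [ht]
      conv_lhs => rw [hY]
      rw [← Finset.sum_add_distrib]
      exact Finset.sum_congr rfl fun a _ => by rw [Matrix.sub_mul, Matrix.one_mul, sub_add_cancel]
  refine ⟨fun A => (g A).1, Computable.fst.comp hg, fun A => ?_⟩
  obtain ⟨h1, h2, h3, h4⟩ := hgp A
  exact ⟨h1, _, _, _, h2, h3, h4⟩

/-! ### From the field `K` to the real numbers -/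

namespace MatrixFamily

variable {K : Subfield ℝ}

theorem toReal_matAt (A : MatrixFamily K) (a : ℕ) :
    A.toReal.matAt a = (A.matAt a).map K.subtype := by
  unfold matAt
  by_cases h : a < A.letters
  · rw [dif_pos h, dif_pos (show a < A.toReal.letters from h)]
    rfl
  · rw [dif_neg h, dif_neg (show ¬ a < A.toReal.letters from h)]
    exact (Matrix.map_zero _ (map_zero K.subtype)).symm

theorem toReal_wordProd (A : MatrixFamily K) (v : List (Fin A.letters)) :
    A.toReal.wordProd v = (A.wordProd v).map K.subtype := by
  induction v with
  | nil => exact (Matrix.map_one _ (map_zero K.subtype) (map_one K.subtype)).symm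
  | cons a v ih =>
    rw [wordProd_cons, Matrix.map_mul, ← ih]
    exact A.toReal.wordProd_cons a v

theorem IsIncrementReduction.toReal {A B : MatrixFamily K} (h : A.IsIncrementReduction B) :
    A.toReal.IsIncrementReduction B.toReal := by
  obtain ⟨hl, P, R, Y, hRP, hA, hY⟩ := h
  have hsum : ∀ f : ℕ → Matrix (Fin A.dim) (Fin B.dim) K,
      (∑ a ∈ Finset.range A.letters, f a).map K.subtype =
        ∑ a ∈ Finset.range A.letters, (f a).map K.subtype :=
    fun f => map_sum (K.subtype.toAddMonoidHom.mapMatrix) f _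
  refine ⟨hl, P.map K.subtype, R.map K.subtype, fun a => (Y a).map K.subtype, ?_,
    fun a ha => ⟨?_, ?_⟩, ?_⟩
  · have h1 := congrArg (fun X => X.map K.subtype) hRP
    simp only [Matrix.map_mul] at h1
    exact h1.trans (Matrix.map_one _ (map_zero K.subtype) (map_one K.subtype))
  · have h1 := congrArg (fun X => X.map K.subtype) (hA a ha).1
    simp only [Matrix.map_mul, Matrix.map_add _ (map_add K.subtype),
      Matrix.map_one _ (map_zero K.subtype) (map_one K.subtype), ← toReal_matAt] at h1
    exact h1
  · have h1 := congrArg (fun X => X.map K.subtype) (hA a ha).2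
    simp only [Matrix.map_mul, ← toReal_matAt] at h1
    exact h1
  · have h1 := congrArg (fun X => X.map K.subtype) hY
    simp only [Matrix.map_mul, Matrix.map_add _ (map_add K.subtype), hsum, ← toReal_matAt] at h1
    exact h1

/-- Entrywise inclusion preserves matrix identities, and its injectivity keeps the fixed row
nonzero. -/
theorem IsFixedRowReduction.toReal {A B : MatrixFamily K} (h : A.IsFixedRowReduction B) :
    A.toReal.IsFixedRowReduction B.toReal := by
  obtain ⟨hl, P, R, c, hRP, hc0, hcP, hA⟩ := h
  refine ⟨hl, P.map K.subtype, R.map K.subtype, c.map K.subtype, ?_, fun h0 => hc0 ?_, ?_,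
    fun a ha => ⟨?_, ?_, ?_⟩⟩
  · have h1 := congrArg (fun X => X.map K.subtype) hRP
    simp only [Matrix.map_mul] at h1
    exact h1.trans (Matrix.map_one _ (map_zero K.subtype) (map_one K.subtype))
  · ext i j
    exact congrFun (congrFun h0 i) j
  · have h1 := congrArg (fun X => X.map K.subtype) hcP
    simp only [Matrix.map_mul] at h1
    exact h1.trans (Matrix.map_zero _ (map_zero K.subtype))
  · have h1 := congrArg (fun X => X.map K.subtype) (hA a ha).1
    simp only [Matrix.map_mul, Matrix.map_sub _ (map_sub K.subtype),
      Matrix.map_one _ (map_zero K.subtype) (map_one K.subtype), ← toReal_matAt] at h1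
    exact h1
  · have h1 := congrArg (fun X => X.map K.subtype) (hA a ha).2.1
    simp only [Matrix.map_mul, ← toReal_matAt] at h1
    exact h1
  · have h1 := congrArg (fun X => X.map K.subtype) (hA a ha).2.2
    simp only [Matrix.map_mul, ← toReal_matAt] at h1
    exact h1

/-- A family is a continuous RCP set if and only if its action on the space spanned by the columns
of the matrices `A_a - 1` is stable. -/
theorem IsIncrementReduction.isContinuousRCP_iff {A B : MatrixFamily ℝ}
    (h : A.IsIncrementReduction B) : A.IsContinuousRCP ↔ B.IsStable := by
  obtain ⟨k, n, MA⟩ := A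
  obtain ⟨k', d, MB⟩ := B
  obtain ⟨hl, P, R, Y, hRP, hA, hY⟩ := h
  dsimp only at hl hA hY P R Y hRP
  subst hl
  have hY' := hY.trans (WFA.sum_matAt (MatrixFamily.mk k' n MA) fun a X => X * Y a)
  rw [← Fin.sum_univ_eq_sum_range] at hY'
  have hA' : ∀ a, P * R * MA a + 1 = MA a + P * R ∧ MA a * P = P * MB a := fun a => by
    simpa [matAt] using hA a a.2
  constructor
  · intro h
    refine h.isStable_of_conj P R hRP (fun a => (hA' a).2) fun N hN => ?_
    -- Since `N` absorbs every `A_a`, the two sums cancel and leave `N P = 0`.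
    have h1 : N * P + N * ∑ a : Fin k', Y a = N * ∑ a : Fin k', MA a * Y a := by
      rw [← hY', Matrix.mul_add]
    rw [Matrix.mul_sum, Matrix.mul_sum] at h1
    simp only [← Matrix.mul_assoc, hN] at h1
    simpa using h1
  · refine isContinuousRCP_of_factor P (fun a => R * (MA a - 1)) (fun a => ?_) fun a => (hA' a).2
    rw [← Matrix.mul_assoc, Matrix.mul_sub, Matrix.mul_one, sub_eq_sub_iff_add_eq_add]
    exact (hA' a).1.symm

end MatrixFamily

/-! ### Continuity criterion, preservation of averages, and extension of scalars for automata -/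

namespace WFA

/-- The continuity criterion for minimal average preserving automata with a common fixed row. -/
theorem IsMinimal.omegaContinuous_iff_of_isFixedRowReduction {A : WFA ℝ} (hmin : A.IsMinimal)
    (hA : A.IsAveragePreserving) (hk : 0 < A.letters) {B : MatrixFamily ℝ}
    (h : A.toMatrixFamily.IsFixedRowReduction B) : A.OmegaContinuous ↔ B.IsStable := by
  obtain ⟨k', d, MB⟩ := B
  obtain ⟨hl, P, R, c, hRP, hc0, hcP, h⟩ := h
  dsimp only at hl P R c hRP hcP h
  subst hl
  have h' : ∀ a, P * R * (A.mat a - 1) = A.mat a - 1 ∧ A.mat a * P = P * MB a ∧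
      c * A.mat a = c := fun a => by
    simpa [MatrixFamily.matAt] using h a a.2
  refine hmin.omegaContinuous_iff_isStable hA hk P R (fun a => R * (A.mat a - 1)) (c 0) hRP
    (fun a => ?_) (fun a => (h' a).2.1) (fun h0 => hc0 ?_) (fun a => congrFun (h' a).2.2 0)
    (congrFun hcP 0)
  · rw [← Matrix.mul_assoc, (h' a).1]
  · ext i j
    rw [Subsingleton.elim i 0, h0]
    rfl

theorem hasCommonFixedRow_of_isFixedRowReduction {K : Type*} [Field K] {A : WFA K}
    {B : MatrixFamily K} (h : A.toMatrixFamily.IsFixedRowReduction B) : A.HasCommonFixedRow := by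
  obtain ⟨hl, P, R, c, hRP, hc0, hcP, h⟩ := h
  refine ⟨c 0, fun h0 => hc0 ?_, fun a => ?_⟩
  · ext i j
    rw [Subsingleton.elim i 0, h0]
    rfl
  · have h1 := (h a a.2).2.2
    rw [MatrixFamily.matAt_coe] at h1
    exact congrFun h1 0

/-- For a fixed row, `c = ∑ c (A_a - 1) X_a = 0`. Applied over the reals, this excludes real fixed
rows on the strength of a certificate found over `K`. -/
theorem not_hasCommonFixedRow_of_sum_eq_one {K : Type*} [Field K] {A : WFA K}
    {X : Fin A.letters → Matrix (Fin A.dim) (Fin A.dim) K}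
    (hX : ∑ a, (A.mat a - 1) * X a = 1) : ¬ A.HasCommonFixedRow := by
  rintro ⟨c, hc0, hc⟩
  refine hc0 ?_
  rw [← Matrix.vecMul_one c, ← hX, Matrix.vecMul_sum]
  refine Finset.sum_eq_zero fun a _ => ?_
  rw [← Matrix.vecMul_vecMul, Matrix.vecMul_sub, hc, Matrix.vecMul_one, sub_self,
    Matrix.zero_vecMul]

/-- The averaging identity for the word function is common to both automata. In `B` it says that `∑
B_a F - |Σ| F` is orthogonal to every `I B_u`, and by left minimality these rows span. -/
theorem SameWordFunction.isAveragePreserving {K : Type*} [Field K] {A B : WFA K}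
    (h : A.SameWordFunction B) (hB : B.IsLeftMinimal) (hA : A.IsAveragePreserving) :
    B.IsAveragePreserving := by
  obtain ⟨hl, h⟩ := h.symm
  have hsum : ∀ v, ∑ a, B.wordFunction (v ++ [a]) = B.letters * B.wordFunction v := by
    intro v
    have h1 := hA.sum_wordFunction (v.map (Fin.cast hl))
    rw [h, show (A.letters : K) = B.letters by rw [hl]] at h1
    rw [← h1]
    refine Fintype.sum_equiv (finCongr hl) _ _ fun a => ?_
    rw [← h]
    simp
  refine sub_eq_zero.1 (dotProduct_eq_zero _ fun x => ?_)
  have hx : x ∈ Submodule.span K (Set.range fun u : List (Fin B.letters) =>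
      Matrix.vecMul B.init (B.wordProd u)) := by rw [hB.span_eq_top]; trivial
  rw [dotProduct_comm]
  induction hx using Submodule.span_induction with
  | mem x h =>
    obtain ⟨v, rfl⟩ := h
    have h1 := hsum v
    rw [show B.wordFunction v = B.wordFunction (v ++ []) by simp] at h1
    simp only [wordFunction_append, B.wordProd_singleton, B.wordProd_nil,
      Matrix.one_mulVec] at h1
    rw [dotProduct_sub, dotProduct_sum, h1, dotProduct_smul, nsmul_eq_mul, sub_self]
  | zero => simp
  | add x y _ _ h h' => rw [add_dotProduct, h, h', add_zero]
  | smul c x _ h => rw [smul_dotProduct, h, smul_zero]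

theorem SameWordFunction.omegaContinuous {A B : WFA ℝ} (h : A.SameWordFunction B)
    (hB : B.OmegaContinuous) : A.OmegaContinuous := by
  obtain ⟨hl, h⟩ := h
  obtain ⟨f, hf, hc⟩ := hB
  refine ⟨fun w => f fun n => Fin.cast hl (w n), fun w => (hf _).congr fun k => ?_,
    hc.comp (continuous_pi fun n =>
      (continuous_of_discreteTopology (f := Fin.cast hl)).comp (continuous_apply n))⟩
  rw [← h]
  simp [wordPrefix, Function.comp_def]

section toReal

variable {K : Subfield ℝ}

theorem toReal_wordFunction (A : WFA K) (v : List (Fin A.letters)) :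
    A.toReal.wordFunction v = A.wordFunction v := by
  have h1 : A.toReal.wordProd v = (A.wordProd v).map K.subtype :=
    A.toMatrixFamily.toReal_wordProd v
  have h2 : ((A.wordProd v).map K.subtype).mulVec (K.subtype ∘ A.final) =
      K.subtype ∘ (A.wordProd v).mulVec A.final :=
    funext fun i => (RingHom.map_mulVec K.subtype _ _ i).symm
  change (K.subtype ∘ A.init) ⬝ᵥ (A.toReal.wordProd v).mulVec (K.subtype ∘ A.final) = _
  have h3 : (A.toReal.wordProd v).mulVec (K.subtype ∘ A.final) =
      K.subtype ∘ (A.wordProd v).mulVec A.final :=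
    (congrArg (fun X : Matrix (Fin A.dim) (Fin A.dim) ℝ => X.mulVec (K.subtype ∘ A.final)) h1).trans
      h2
  exact (congrArg (fun y => (K.subtype ∘ A.init) ⬝ᵥ y) h3).trans
    (RingHom.map_dotProduct K.subtype _ _).symm

theorem SameWordFunction.toReal {A B : WFA K} (h : A.SameWordFunction B) :
    A.toReal.SameWordFunction B.toReal := by
  obtain ⟨hl, h⟩ := h
  exact ⟨hl, fun v => (B.toReal_wordFunction _).trans
    ((congrArg Subtype.val (h v)).trans (A.toReal_wordFunction v).symm)⟩

/-- The unit vectors are combinations over `K`, hence over the reals, and they span the real space.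
-/
theorem span_comp_eq_top {n : ℕ} {ι : Type*} {f : ι → Fin n → K}
    (h : Submodule.span K (Set.range f) = ⊤) :
    Submodule.span ℝ (Set.range fun i => K.subtype ∘ f i) = ⊤ := by
  have hK : ∀ y : Fin n → K, K.subtype ∘ y ∈
      Submodule.span ℝ (Set.range fun i => K.subtype ∘ f i) := by
    intro y
    have hy : y ∈ Submodule.span K (Set.range f) := h ▸ Submodule.mem_top
    induction hy using Submodule.span_induction with
    | mem y h =>
      obtain ⟨i, rfl⟩ := h
      exact Submodule.subset_span ⟨i, rfl⟩
    | zero =>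
      rw [show K.subtype ∘ (0 : Fin n → K) = 0 by ext; simp]
      exact Submodule.zero_mem _
    | add x y _ _ h h' =>
      rw [show K.subtype ∘ (x + y) = K.subtype ∘ x + K.subtype ∘ y by ext; simp]
      exact Submodule.add_mem _ h h'
    | smul c x _ h =>
      rw [show K.subtype ∘ (c • x) = (c : ℝ) • (K.subtype ∘ x) by ext; simp]
      exact Submodule.smul_mem _ _ h
  refine eq_top_iff.2 fun y _ => ?_
  rw [← Matrix.vecMul_one y, Matrix.vecMul_eq_sum]
  refine Submodule.sum_mem _ fun i _ => Submodule.smul_mem _ _ ?_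
  have h1 : (1 : Matrix (Fin n) (Fin n) ℝ) i = K.subtype ∘ (1 : Matrix (Fin n) (Fin n) K) i := by
    ext j
    by_cases hij : i = j <;> simp [Matrix.one_apply, hij]
  rw [h1]
  exact hK _

theorem IsMinimal.toReal {A : WFA K} (h : A.IsMinimal) : A.toReal.IsMinimal := by
  have hprod : ∀ v : List (Fin A.letters), A.toReal.wordProd v = (A.wordProd v).map K.subtype :=
    A.toMatrixFamily.toReal_wordProd
  constructor
  · refine isLeftMinimal_iff.2 (Eq.trans ?_ (span_comp_eq_top h.1.span_eq_top))
    refine congrArg (fun f => Submodule.span ℝ (Set.range f)) (funext fun u => ?_)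
    refine (congrArg (Matrix.vecMul A.toReal.init) (hprod u)).trans ?_
    exact funext fun i => (RingHom.map_vecMul K.subtype (A.wordProd u) A.init i).symm
  · refine isRightMinimal_iff.2 (Eq.trans ?_ (span_comp_eq_top h.2.span_eq_top))
    refine congrArg (fun f => Submodule.span ℝ (Set.range f)) (funext fun u => ?_)
    refine (congrArg (fun X : Matrix (Fin A.dim) (Fin A.dim) ℝ => Matrix.mulVec X (K.subtype ∘ A.final))
      (hprod u)).trans ?_
    exact funext fun i => (RingHom.map_mulVec K.subtype (A.wordProd u) A.final i).symm

theorem toReal_sum_eq_one {A : WFA K} {X : Fin A.letters → Matrix (Fin A.dim) (Fin A.dim) K}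
    (hX : ∑ a, (A.mat a - 1) * X a = 1) :
    ∃ Y : Fin A.toReal.letters → Matrix (Fin A.toReal.dim) (Fin A.toReal.dim) ℝ,
      ∑ a, (A.toReal.mat a - 1) * Y a = 1 := by
  refine ⟨fun a => (X a).map K.subtype, ?_⟩
  have h1 := congrArg K.subtype.mapMatrix hX
  rw [map_sum, map_one] at h1
  simp only [map_mul, map_sub, map_one] at h1
  exact h1

end toReal

end WFA

/-! ### The theorem -/

/-- The negative instance that the reduction outputs when no canonical form exists and the automaton
has states. -/
theorem MatrixFamily.not_isStable_one : ¬ (MatrixFamily.mk 1 1 fun _ => (1 :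
    Matrix (Fin 1) (Fin 1) ℝ)).IsStable := by
  intro h
  have h1 : ∀ v, (MatrixFamily.mk 1 1 fun _ => (1 : Matrix (Fin 1) (Fin 1) ℝ)).wordProd v = 1 := by
    intro v
    simp [wordProd]
  have h2 := h fun _ => 0
  simp only [HasLimit, h1] at h2
  exact one_ne_zero (tendsto_nhds_unique tendsto_const_nhds h2)

theorem MatrixFamily.isStable_of_dim_eq_zero {B : MatrixFamily ℝ} (h : B.dim = 0) :
    B.IsStable := by
  have : IsEmpty (Fin B.dim) := by rw [h]; infer_instance
  exact fun w => tendsto_const_nhds.congr fun k => Subsingleton.elim _ _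

theorem mainTheorem6 (K : Subfield ℝ) [Primcodable K] (hK : EffectiveArithmetic K) :
    (apWFAContinuity K).ReducibleTo (matrixProductStability K) ∧
    (matrixProductContinuity K).ReducibleTo (matrixProductStability K) ∧
    ∃ (minimize : WFA K → WFA K) (isZero : WFA K → Bool)
      (canonicalForm : WFA K → Option (WFA K × MatrixFamily K)),
      Computable minimize ∧ Computable isZero ∧ Computable canonicalForm ∧
      ∀ A : WFA K, 0 < A.letters → A.toReal.IsAveragePreserving →
        (minimize A).toReal.IsMinimal ∧
        A.toReal.SameWordFunction (minimize A).toReal ∧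
        (minimize A).toReal.IsAveragePreserving ∧
        (isZero (minimize A) = true ↔ (minimize A).toReal.OmegaZero) ∧
        (canonicalForm (minimize A) = none ↔ ¬ (minimize A).toReal.HasCommonFixedRow) ∧
        (∀ C B, canonicalForm (minimize A) = some (C, B) →
          (minimize A).IsCanonicalForm C B) ∧
        (A.toReal.OmegaContinuous ↔
          isZero (minimize A) = true ∨
          ∃ C B, canonicalForm (minimize A) = some (C, B) ∧ B.toReal.IsStable) := by
  obtain ⟨minimize, hcm, hm⟩ := WFA.exists_computable_minimize hK.add hK.mul
  obtain ⟨canon, hcc, hc⟩ := WFA.exists_computable_canonicalForm hK.add hK.mul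
  obtain ⟨incr, hci, hi⟩ := MatrixFamily.exists_computable_incrementReduction hK.add hK.mul
  -- On a minimal average preserving automaton the `ω`-function vanishes exactly when there are no
  -- states.
  let isZero : WFA K → Bool := fun A => decide (A.dim = 0)
  have hcz : Computable isZero :=
    (ComputablePred.eq WFA.computable_dim (Computable.const 0)).decide
  have hletters : ∀ A, (minimize A).letters = A.letters := fun A => (hm A).2.choose.symm
  have main : ∀ A : WFA K, 0 < A.letters → A.toReal.IsAveragePreserving →
      (minimize A).toReal.IsMinimal ∧ A.toReal.SameWordFunction (minimize A).toReal ∧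
      (minimize A).toReal.IsAveragePreserving ∧
      (isZero (minimize A) = true ↔ (minimize A).toReal.OmegaZero) ∧
      (canon (minimize A) = none ↔ ¬ (minimize A).toReal.HasCommonFixedRow) ∧
      (∀ C B, canon (minimize A) = some (C, B) → (minimize A).IsCanonicalForm C B) ∧
      (A.toReal.OmegaContinuous ↔ isZero (minimize A) = true ∨
        ∃ C B, canon (minimize A) = some (C, B) ∧ B.toReal.IsStable) := by
    intro A hk hA
    have hmin := (hm A).1.toReal
    have hsame := (hm A).2.toReal
    have hap := hsame.isAveragePreserving hmin.1 hA
    have hk' : 0 < (minimize A).toReal.letters := (hletters A).symm ▸ hk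
    have hzero : isZero (minimize A) = true ↔ (minimize A).toReal.OmegaZero := by
      simp only [isZero, decide_eq_true_eq]
      exact ⟨fun h => WFA.omegaZero_of_dim_eq_zero h, fun h => hmin.dim_eq_zero hap hk' h⟩
    have hred : ∀ C B, canon (minimize A) = some (C, B) →
        (minimize A).toReal.toMatrixFamily.IsFixedRowReduction B.toReal := fun C B h =>
      ((hc _).2 C B h).2.toReal
    have hone : canon (minimize A) = none →
        ∃ Y : Fin (minimize A).toReal.letters → Matrix _ _ ℝ,
          ∑ a, ((minimize A).toReal.mat a - 1) * Y a = 1 := fun h => by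
      obtain ⟨X, hX⟩ := (hc _).1 h
      exact WFA.toReal_sum_eq_one hX
    have hiff : A.toReal.OmegaContinuous ↔ (minimize A).toReal.OmegaContinuous :=
      ⟨hsame.symm.omegaContinuous, hsame.omegaContinuous⟩
    refine ⟨hmin, hsame, hap, hzero, ⟨fun h => ?_, fun h => ?_⟩,
      fun C B h => ((hc _).2 C B h).1, ?_⟩
    · obtain ⟨Y, hY⟩ := hone h
      exact WFA.not_hasCommonFixedRow_of_sum_eq_one hY
    · by_contra hne
      obtain ⟨⟨C, B⟩, hCB⟩ := Option.ne_none_iff_exists'.1 hne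
      exact h (WFA.hasCommonFixedRow_of_isFixedRowReduction (hred C B hCB))
    · rw [hiff]
      constructor
      · intro h
        rcases hcan : canon (minimize A) with _ | ⟨C, B⟩
        -- Without a canonical form the columns of the `A_a - 1` span, so continuity is possible
        -- only for the zero function.
        · obtain ⟨Y, hY⟩ := hone hcan
          exact Or.inl (hzero.2 (hmin.omegaZero_of_sum_eq_one hap hk' h Y hY))
        · exact Or.inr ⟨C, B, rfl,
            (hmin.omegaContinuous_iff_of_isFixedRowReduction hap hk' (hred C B hcan)).1 h⟩
      · rintro (h | ⟨C, B, hCB, hB⟩)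
        · exact (hzero.1 h).omegaContinuous
        · exact (hmin.omegaContinuous_iff_of_isFixedRowReduction hap hk' (hred C B hCB)).2 hB
  -- With no states the output is a trivially stable family of empty matrices; with states but no
  -- canonical form it is the unstable `1 × 1` identity; otherwise it is the family of the `B_a`.
  -- Both constant outputs have one letter, because inputs must be nonempty families.
  refine ⟨⟨fun A => if (minimize A).dim = 0 then ⟨1, 0, 0⟩ else
      Option.casesOn (canon (minimize A)) ⟨1, 1, fun _ => 1⟩ fun x => x.2, ?_, ?_⟩,
    ⟨incr, hci, fun A hA => ⟨lt_of_lt_of_eq hA (hi A).1.symm, (hi A).toReal.isContinuousRCP_iff⟩⟩,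
    minimize, isZero, canon, hcm, hcz, hcc, main⟩
  · exact Computable.ite (ComputablePred.eq (WFA.computable_dim.comp hcm) (Computable.const 0))
      (Computable.const _) (Computable.option_casesOn (hcc.comp hcm) (Computable.const _)
        (Computable.snd.comp Computable.snd))
  · rintro A ⟨hk, hA⟩
    obtain ⟨-, -, -, -, -, -, hiff⟩ := main A hk hA
    simp only [isZero, decide_eq_true_eq] at hiff
    change _ ∧ (A.toReal.OmegaContinuous ↔ _)
    rw [hiff]
    by_cases hd : (minimize A).dim = 0
    · simp only [hd, if_true, true_or, true_iff]
      exact ⟨Nat.one_pos, MatrixFamily.isStable_of_dim_eq_zero rfl⟩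
    · simp only [hd, if_false, false_or]
      rcases hcan : canon (minimize A) with _ | ⟨C, B⟩
      · refine ⟨Nat.one_pos, ⟨fun ⟨_, _, h, _⟩ => by simp at h, fun h => ?_⟩⟩
        refine absurd h ?_
        have h1 : (MatrixFamily.mk 1 1 fun _ => (1 : Matrix (Fin 1) (Fin 1) K)).toReal =
            MatrixFamily.mk 1 1 fun _ => 1 :=
          congrArg (MatrixFamily.mk 1 1) (funext fun _ =>
            Matrix.map_one _ (map_zero K.subtype) (map_one K.subtype))
        intro h2
        change (MatrixFamily.mk 1 1 fun _ => (1 : Matrix (Fin 1) (Fin 1) K)).toReal.IsStable at h2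
        rw [h1] at h2
        exact MatrixFamily.not_isStable_one h2
      · refine ⟨?_, ⟨fun ⟨_, _, h, hB⟩ => ?_, fun h => ⟨C, B, rfl, h⟩⟩⟩
        · have h1 : B.letters = (minimize A).letters := ((hc _).2 C B hcan).2.1
          change 0 < B.letters
          rw [h1, hletters]
          exact hk
        · simp only [Option.some.injEq, Prod.mk.injEq] at h
          obtain ⟨rfl, rfl⟩ := h
          exact hB
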